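/- Let $(M,g)$ be a smooth $n$-dimensional Riemannian manifold, $(x^1,\dots,x^n)$ a local chart of $M$ with domain $U$, and $(q^1,\dots,q^n,p_1,\dots,p_n)$ the induced chart of the cotangent bundle $T^*M$ over $U$. The summation convention is used. Let $\Gamma^k_{ij}$ be the Christoffel symbols of $g$, let $R^h_{kij}$ be the components of its curvature tensor, $R(\partial_i,\partial_j)\partial_k=R^h_{kij}\partial_h$ with $R(X,Y)=\nabla_X\nabla_Y-\nabla_Y\nabla_X-\nabla_{[X,Y]}$, and put $g^{0i}=p_hg^{hi}$, $t=\tfrac12 g^{ik}p_ip_k$ and $$\frac{\delta}{\delta q^i}=\frac{\partial}{\partial q^i}+p_k\Gamma^k_{ih}\frac{\partial}{\partial p_h}.$$ Let $A>0$ and let $\lambda,b_1:(0,\infty)\to\mathbb R$ be smooth functions with $\lambda>0$ and $A\lambda+2b_1>0$. Let $J$ be the almost complex structure on the nonzero cotangent bundle $T^*_0M$ ($T^*M$ without the zero section) given by $$J\frac{\delta}{\delta q^i}=J^{(1)}_{ij}\frac{\partial}{\partial p_j},\qquad J\frac{\partial}{\partial p_i}=-J_{(2)}^{ij}\frac{\delta}{\delta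 q^j},$$ $$J^{(1)}_{ij}=At\lambda\, g_{ij}+b_1p_ip_j,\qquad J_{(2)}^{ij}=\frac{1}{At\lambda}\,g^{ij}-\frac{b_1}{At^2\lambda(A\lambda+2b_1)}\,g^{0i}g^{0j},$$ where $\lambda,b_1$ are evaluated at $t$. Put $$F=At\{(\lambda+2t\lambda')b_1+A\lambda(\lambda+t\lambda')\}.$$ Then the Nijenhuis tensor $N(X,Y)=[JX,JY]-J[JX,Y]-J[X,JY]-[X,Y]$ of $J$ is given, over $U$, by $$N\Big(\frac{\delta}{\delta q^i},\frac{\delta}{\delta q^j}\Big)=\{F(\delta^h_ig_{jk}-\delta^h_jg_{ik})-R^h_{kij}\}\,p_h\frac{\partial}{\partial p_k},$$ $$N\Big(\frac{\delta}{\delta q^i},\frac{\partial}{\partial p_j}\Big)=J_{(2)}^{kl}J_{(2)}^{jr}\{F(\delta^h_ig_{rl}-\delta^h_rg_{il})-R^h_{lir}\}\,p_h\frac{\delta}{\delta q^k},$$ $$N\Big(\frac{\partial}{\partial p_i},\frac{\partial}{\partial p_j}\Big)=J_{(2)}^{ir}J_{(2)}^{jl}\{F(\delta^h_lg_{rk}-\delta^h_rg_{lk})-R^h_{klr}\}\,p_h\frac{\partial}{\partial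 p_k}.$$ -/

import Mathlib

open scoped Manifold ContDiff Bundle

/-! ### The Nijenhuis tensor of a field of endomorphisms of the tangent bundle -/

/-- `N(X,Y) = [JX,JY] - J[JX,Y] - J[X,JY] - [X,Y]`, for a field `J` of endomorphisms of the tangent
spaces and vector fields `X`, `Y` on a manifold; `[·,·]` is the Lie bracket of vector fields. The
value at a point only depends on the restrictions of `J`, `X`, `Y` to a neighbourhood of it. -/
noncomputable def nijenhuis {E H N : Type*} [NormedAddCommGroup E] [NormedSpace ℝ E]
    [TopologicalSpace H] (I : ModelWithCorners ℝ E H) [TopologicalSpace N] [ChartedSpace H N]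
    (J : (P : N) → TangentSpace I P →L[ℝ] TangentSpace I P)
    (X Y : (P : N) → TangentSpace I P) (P : N) : TangentSpace I P :=
  VectorField.mlieBracket I (fun Q => J Q (X Q)) (fun Q => J Q (Y Q)) P
    - J P (VectorField.mlieBracket I (fun Q => J Q (X Q)) Y P)
    - J P (VectorField.mlieBracket I X (fun Q => J Q (Y Q)) P)
    - VectorField.mlieBracket I X Y P

/-! ### The cotangent bundle -/

/-- The model space of an `n`-dimensional manifold. -/
abbrev ModelE (n : ℕ) : Type := EuclideanSpace ℝ (Fin n)

/-- The cotangent bundle `T*M` of an `n`-dimensional manifold `M`: its elements are pairs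
`P = ⟨x, p⟩` of a point `x` of `M` and a covector `p` at `x`. -/
abbrev Cotangent (n : ℕ) (M : Type*) [TopologicalSpace M] [ChartedSpace (ModelE n) M]
    [IsManifold 𝓘(ℝ, ModelE n) ∞ M] : Type _ :=
  Bundle.TotalSpace (ModelE n →L[ℝ] ℝ) (fun x : M => TangentSpace 𝓘(ℝ, ModelE n) x →L[ℝ] ℝ)

/-- The model with corners of the `2n`-dimensional manifold `T*M`. -/
noncomputable abbrev modCot (n : ℕ) :
    ModelWithCorners ℝ (ModelE n × (ModelE n →L[ℝ] ℝ)) (ModelProd (ModelE n) (ModelE n →L[ℝ] ℝ)) :=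
  𝓘(ℝ, ModelE n).prod 𝓘(ℝ, ModelE n →L[ℝ] ℝ)

/-- Smooth Riemannian metrics on `M`. -/
abbrev RMetric (n : ℕ) (M : Type*) [TopologicalSpace M] [ChartedSpace (ModelE n) M]
    [IsManifold 𝓘(ℝ, ModelE n) ∞ M] : Type _ :=
  Bundle.ContMDiffRiemannianMetric 𝓘(ℝ, ModelE n) ∞ (ModelE n)
    (fun x : M => TangentSpace 𝓘(ℝ, ModelE n) x)

/-- The `i`-th vector of the standard basis of the model space. -/
noncomputable abbrev stdVec {n : ℕ} (i : Fin n) : ModelE n := EuclideanSpace.single i (1 : ℝ)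

namespace CotLift

variable {n : ℕ} {M : Type*} [TopologicalSpace M] [ChartedSpace (ModelE n) M]
  [IsManifold 𝓘(ℝ, ModelE n) ∞ M]

/-! ### Local coordinates on the base: `φ = (x^1, …, x^n)` is a local chart of `M` -/

/-- The coordinate vector field `∂/∂x^i`. -/
noncomputable def coordVec (φ : OpenPartialHomeomorph M (ModelE n)) (i : Fin n) (x : M) :
    TangentSpace 𝓘(ℝ, ModelE n) x :=
  VectorField.mpullback 𝓘(ℝ, ModelE n) 𝓘(ℝ, ModelE n) φ (fun _ => (stdVec i : ModelE n)) x

/-- The partial derivative `∂f/∂x^i` of a function on `M`. -/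
noncomputable def pderiv (φ : OpenPartialHomeomorph M (ModelE n)) (i : Fin n) (f : M → ℝ) (x : M) :
    ℝ :=
  fderiv ℝ (fun y => f (φ.symm y)) (φ x) (stdVec i)

variable (g : RMetric n M) (φ : OpenPartialHomeomorph M (ModelE n))

/-- The matrix of the components `g_{ij}` of the metric. -/
noncomputable def gLow (x : M) : Matrix (Fin n) (Fin n) ℝ :=
  Matrix.of fun i j => g.inner x (coordVec φ i x) (coordVec φ j x)

/-- The inverse matrix, with entries `g^{ij}`. -/
noncomputable def gUp (x : M) : Matrix (Fin n) (Fin n) ℝ := (gLow g φ x)⁻¹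

/-- The Christoffel symbols `Γ^k_{ij}` of the Levi-Civita connection. -/
noncomputable def christoffel (k i j : Fin n) (x : M) : ℝ :=
  (1 / 2 : ℝ) * ∑ l, gUp g φ x k l *
    (pderiv φ i (fun y => gLow g φ y j l) x + pderiv φ j (fun y => gLow g φ y i l) x
      - pderiv φ l (fun y => gLow g φ y i j) x)

/-- The components `R^h_{kij}` of the curvature tensor field:
`R(∂/∂x^i, ∂/∂x^j) ∂/∂x^k = R^h_{kij} ∂/∂x^h`, where
`R(X, Y) = ∇_X ∇_Y - ∇_Y ∇_X - ∇_{[X, Y]}`. -/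
noncomputable def curv (h k i j : Fin n) (x : M) : ℝ :=
  pderiv φ i (christoffel g φ h j k) x - pderiv φ j (christoffel g φ h i k) x
    + ∑ l, (christoffel g φ h i l x * christoffel g φ l j k x
      - christoffel g φ h j l x * christoffel g φ l i k x)

/-! ### The induced chart `(q^1, …, q^n, p_1, …, p_n)` of `T*M` and the adapted frame -/

/-- The coordinate `p_i` of `P`, that is `P = p_i dx^i`. -/
noncomputable def pLow (P : Cotangent n M) (i : Fin n) : ℝ := P.2 (coordVec φ i P.1)

/-- The chart `(q, p)` of `T*M` induced by the chart `φ` of `M`, as a map on `T*M`; it is a chart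
on the part of `T*M` over the domain of `φ`. -/
noncomputable def inducedChart (P : Cotangent n M) : ModelE n × ModelE n :=
  (φ P.1, WithLp.toLp 2 (pLow φ P))

/-- The vector field on `T*M` with the constant components `v` in the induced chart. -/
noncomputable def inducedVec (v : ModelE n × ModelE n) (P : Cotangent n M) :
    TangentSpace (modCot n) P :=
  VectorField.mpullback (modCot n) 𝓘(ℝ, ModelE n × ModelE n) (inducedChart φ) (fun _ => v) P

/-- The vertical vector field `∂/∂p_i`. -/
noncomputable def dp (i : Fin n) (P : Cotangent n M) : TangentSpace (modCot n) P :=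
  inducedVec φ ((0 : ModelE n), stdVec i) P

/-- The vector field `∂/∂q^i`. -/
noncomputable def dq (i : Fin n) (P : Cotangent n M) : TangentSpace (modCot n) P :=
  inducedVec φ (stdVec i, (0 : ModelE n)) P

/-- The horizontal vector field `δ/δq^i = ∂/∂q^i + Γ^0_{ih} ∂/∂p_h`, where
`Γ^0_{ih} = p_k Γ^k_{ih}`. -/
noncomputable def deltaq (i : Fin n) (P : Cotangent n M) : TangentSpace (modCot n) P :=
  dq φ i P + ∑ h, (∑ k, pLow φ P k * christoffel g φ k i h P.1) • dp φ h P

/-- `g^{0i} = p_h g^{hi}`. -/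
noncomputable def pUp (P : Cotangent n M) (i : Fin n) : ℝ := ∑ h, pLow φ P h * gUp g φ P.1 h i

/-- The energy density `t = (1/2) g^{ik} p_i p_k`. -/
noncomputable def energy (P : Cotangent n M) : ℝ :=
  (1 / 2 : ℝ) * ∑ i, ∑ k, gUp g φ P.1 i k * pLow φ P i * pLow φ P k

/-! ### The natural almost complex structures of diagonal type with `a₁ = A t λ` -/

/-- `J^{(1)}_{ij} = a₁(t) g_{ij} + b₁(t) p_i p_j` with `a₁ = A t λ`. -/
noncomputable def J1 (A : ℝ) (lam b₁ : ℝ → ℝ) (P : Cotangent n M) (i j : Fin n) : ℝ :=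
  A * energy g φ P * lam (energy g φ P) * gLow g φ P.1 i j
    + b₁ (energy g φ P) * pLow φ P i * pLow φ P j

/-- `J_{(2)}^{ij} = a₂(t) g^{ij} + b₂(t) g^{0i} g^{0j}` with `a₂ = 1 / (A t λ)` and
`b₂ = - b₁ / (A t² λ (A λ + 2 b₁))`. -/
noncomputable def J2 (A : ℝ) (lam b₁ : ℝ → ℝ) (P : Cotangent n M) (i j : Fin n) : ℝ :=
  1 / (A * energy g φ P * lam (energy g φ P)) * gUp g φ P.1 i j
    + -b₁ (energy g φ P) / (A * energy g φ P ^ 2 * lam (energy g φ P)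
        * (A * lam (energy g φ P) + 2 * b₁ (energy g φ P))) * pUp g φ P i * pUp g φ P j

/-- The field `J` of endomorphisms of the tangent spaces of `T*M` is, on the nonzero cotangent
vectors over the domain of the chart `φ`, the operator given in the adapted frame by
`J (δ/δq^i) = J^{(1)}_{ij} ∂/∂p_j` and `J (∂/∂p_i) = - J_{(2)}^{ij} δ/δq^j`.
(The adapted frame is a basis, so this determines `J` there.) -/
def IsDiagonalStructure (A : ℝ) (lam b₁ : ℝ → ℝ)
    (J : (P : Cotangent n M) → TangentSpace (modCot n) P →L[ℝ] TangentSpace (modCot n) P) : Prop :=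
  ∀ P : Cotangent n M, P.1 ∈ φ.source → P.2 ≠ 0 → ∀ i : Fin n,
    J P (deltaq g φ i P) = ∑ j, J1 g φ A lam b₁ P i j • dp φ j P ∧
    J P (dp φ i P) = -∑ j, J2 g φ A lam b₁ P i j • deltaq g φ j P

/-- The Kronecker symbol. -/
def kron (h i : Fin n) : ℝ := if h = i then 1 else 0

/-- The function `A t {(λ + 2 t λ') b₁ + A λ (λ + t λ')}` of `t`. -/
noncomputable def nijCoeff (A : ℝ) (lam b₁ : ℝ → ℝ) (t : ℝ) : ℝ :=
  A * t * ((lam t + 2 * t * deriv lam t) * b₁ t + A * lam t * (lam t + t * deriv lam t))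

/-- `{A t ((λ + 2 t λ') b₁ + A λ (λ + t λ')) (δ^h_i g_{jk} - δ^h_j g_{ik}) - R^h_{kij}} p_h`,
the coefficient with the free indices `k`, `i`, `j`. -/
noncomputable def nijComp (A : ℝ) (lam b₁ : ℝ → ℝ) (P : Cotangent n M) (k i j : Fin n) : ℝ :=
  ∑ h, (nijCoeff A lam b₁ (energy g φ P)
      * (kron h i * gLow g φ P.1 j k - kron h j * gLow g φ P.1 i k)
    - curv g φ h k i j P.1) * pLow φ P h

end CotLift

/-! ### The Nijenhuis tensor in a vector space -/

/-! The induced chart carries everything to an open piece of phase space, where `J` becomes an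
explicit operator `Jop` and the brackets are ordinary derivatives. `apply_ofComponents` and
`mlieBracket_ofComponents` give this reduction, combined in `nijenhuis_eq_ofComponents`.

In a vector space, J² = -1 makes the derivatives of X and Y cancel in N(X,Y)
(`lieBracket_eq_nijenhuisForm`), so N is bilinear in the values at the point. Differentiating J² =
-1 gives N(u,Jv) = N(Ju,v) = -J N(u,v). Since ∂/∂p_j = J(J_(2)^{jr} δ/δq^r), all three formulas
follow from the value on a pair of horizontal fields.

Write V_i = J δ/δq^i, a vertical field. Then N(δ/δq^i, δ/δq^j) = [V_i,V_j] - J([V_i,δ/δq^j] +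
[δ/δq^i,V_j]) - [δ/δq^i,δ/δq^j]. The last bracket is the curvature contracted with p
(`lieBracket_horVec`). The sum inside J vanishes (`lieBracket_mixed`), because the energy t is
constant along horizontal directions and the connection is metric and torsion-free. The first
bracket is a computation in the fibre and produces the coefficient F (`lieBracket_vert_J1`). -/

section FlatNijenhuis

variable {E : Type*} [NormedAddCommGroup E] [NormedSpace ℝ E]

/-- The value at `z` of the Nijenhuis tensor of a field `J` of endomorphisms of a normed space,
as a bilinear expression in tangent vectors. -/
noncomputable def nijenhuisForm (J : E → E →L[ℝ] E) (z u v : E) : E :=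
  fderiv ℝ J z (J z u) v - fderiv ℝ J z (J z v) u
    + J z (fderiv ℝ J z v u) - J z (fderiv ℝ J z u v)

theorem nijenhuisForm_swap (J : E → E →L[ℝ] E) (z u v : E) :
    nijenhuisForm J z u v = -nijenhuisForm J z v u := by
  simp only [nijenhuisForm]; abel

theorem nijenhuisForm_sum_smul_right {ι : Type*} (s : Finset ι) (J : E → E →L[ℝ] E) (z u : E)
    (c : ι → ℝ) (v : ι → E) :
    nijenhuisForm J z u (∑ i ∈ s, c i • v i) = ∑ i ∈ s, c i • nijenhuisForm J z u (v i) := by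
  simp only [nijenhuisForm, map_sum, map_smul, smul_sub, smul_add, Finset.sum_sub_distrib,
    Finset.sum_add_distrib, _root_.sum_apply, _root_.smul_apply]

theorem nijenhuisForm_sum_smul_left {ι : Type*} (s : Finset ι) (J : E → E →L[ℝ] E) (z v : E)
    (c : ι → ℝ) (u : ι → E) :
    nijenhuisForm J z (∑ i ∈ s, c i • u i) v = ∑ i ∈ s, c i • nijenhuisForm J z (u i) v := by
  rw [nijenhuisForm_swap, nijenhuisForm_sum_smul_right, ← Finset.sum_neg_distrib]
  refine Finset.sum_congr rfl fun i _ => ?_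
  rw [nijenhuisForm_swap J z v, smul_neg, neg_neg]

/-- The product rule applied to J² = -1: every directional derivative of J anticommutes with J. The
identity is therefore needed on a neighbourhood, not only at `z`. -/
theorem fderiv_comp_self_eq_neg {J : E → E →L[ℝ] E} {z : E} (hJ : DifferentiableAt ℝ J z)
    (hJJ : ∀ᶠ y in nhds z, ∀ v, J y (J y v) = -v) (w v : E) :
    fderiv ℝ J z w (J z v) = -J z (fderiv ℝ J z w v) := by
  have h : (fun y => J y (J y v)) =ᶠ[nhds z] fun _ => -v := hJJ.mono fun y hy => hy v
  have h1 := h.fderiv_eq (𝕜 := ℝ)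
  have h2 : HasFDerivAt (fun y => J y v) ((fderiv ℝ J z).flip v) z := by
    simpa using hJ.hasFDerivAt.clm_apply (hasFDerivAt_const v z)
  have h3 := hJ.hasFDerivAt.clm_apply h2
  rw [h3.fderiv, fderiv_fun_const] at h1
  have h4 := congrArg (fun T : E →L[ℝ] E => T w) h1
  simp at h4
  exact eq_neg_of_add_eq_zero_right h4

/-- Moving J past each derivative of J costs a sign, and J² = -1 removes the double occurrences.
This is what reduces vertical arguments to horizontal ones. -/
theorem nijenhuisForm_apply_right {J : E → E →L[ℝ] E} {z : E} (hJ : DifferentiableAt ℝ J z)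
    (hJJ : ∀ᶠ y in nhds z, ∀ v, J y (J y v) = -v) (u v : E) :
    nijenhuisForm J z u (J z v) = -J z (nijenhuisForm J z u v) := by
  have hz := hJJ.self_of_nhds
  simp only [nijenhuisForm, fderiv_comp_self_eq_neg hJ hJJ, hz, map_neg, map_sub, map_add,
    _root_.neg_apply]
  abel

theorem nijenhuisForm_apply_left {J : E → E →L[ℝ] E} {z : E} (hJ : DifferentiableAt ℝ J z)
    (hJJ : ∀ᶠ y in nhds z, ∀ v, J y (J y v) = -v) (u v : E) :
    nijenhuisForm J z (J z u) v = -J z (nijenhuisForm J z u v) := by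
  rw [nijenhuisForm_swap, nijenhuisForm_apply_right hJ hJJ, nijenhuisForm_swap J z u, map_neg]

-- Tensoriality: after expansion, each derivative of X or Y occurs twice with opposite signs once J²
-- = -1 is used at the single point `z`. Only derivatives of J survive.
open VectorField in
theorem lieBracket_eq_nijenhuisForm {J : E → E →L[ℝ] E} {z : E} (hJ : DifferentiableAt ℝ J z)
    (hJJ : ∀ v, J z (J z v) = -v) {X Y : E → E} (hX : DifferentiableAt ℝ X z)
    (hY : DifferentiableAt ℝ Y z) :
    lieBracket ℝ (fun y => J y (X y)) (fun y => J y (Y y)) z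
      - J z (lieBracket ℝ (fun y => J y (X y)) Y z)
      - J z (lieBracket ℝ X (fun y => J y (Y y)) z)
      - lieBracket ℝ X Y z = nijenhuisForm J z (X z) (Y z) := by
  have h1 := (hJ.hasFDerivAt.clm_apply hX.hasFDerivAt).fderiv
  have h2 := (hJ.hasFDerivAt.clm_apply hY.hasFDerivAt).fderiv
  simp only [lieBracket_eq, h1, h2, nijenhuisForm]
  simp only [_root_.add_apply, ContinuousLinearMap.comp_apply,
    ContinuousLinearMap.flip_apply, map_add, map_sub, hJJ]
  abel

end FlatNijenhuis

/-! ### A metric on an open set of the model space, and the phase space over it -/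

/-- The phase space, with points `z = (q, p)`. -/
abbrev PhaseSpace (n : ℕ) : Type := ModelE n × ModelE n

namespace CotModel

variable {n : ℕ} (G : ModelE n → Matrix (Fin n) (Fin n) ℝ)

/-- The Christoffel symbols `Γ^k_{ij}` of a field of matrices. -/
noncomputable def christoffel (k i j : Fin n) (x : ModelE n) : ℝ :=
  (1 / 2 : ℝ) * ∑ l, (G x)⁻¹ k l *
    (fderiv ℝ (fun y => G y j l) x (stdVec i) + fderiv ℝ (fun y => G y i l) x (stdVec j)
      - fderiv ℝ (fun y => G y i j) x (stdVec l))

/-- The components `R^h_{kij}` of the curvature. -/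
noncomputable def curv (h k i j : Fin n) (x : ModelE n) : ℝ :=
  fderiv ℝ (christoffel G h j k) x (stdVec i) - fderiv ℝ (christoffel G h i k) x (stdVec j)
    + ∑ l, (christoffel G h i l x * christoffel G l j k x
      - christoffel G h j l x * christoffel G l i k x)

/-- The coefficients `Γ^0_{ih} = p_k Γ^k_{ih}`. -/
noncomputable def hor (i h : Fin n) (z : PhaseSpace n) : ℝ :=
  ∑ k, z.2 k * christoffel G k i h z.1

/-- The components `p_h g^{hi}`. -/
noncomputable def pUp (z : PhaseSpace n) (i : Fin n) : ℝ := ∑ h, z.2 h * (G z.1)⁻¹ h i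

/-- The energy density. -/
noncomputable def energy (z : PhaseSpace n) : ℝ :=
  (1 / 2 : ℝ) * ∑ i, ∑ k, (G z.1)⁻¹ i k * z.2 i * z.2 k

variable (A : ℝ) (lam b₁ : ℝ → ℝ)

/-- The components `J^{(1)}_{ij}`. -/
noncomputable def J1 (z : PhaseSpace n) (i j : Fin n) : ℝ :=
  A * energy G z * lam (energy G z) * G z.1 i j + b₁ (energy G z) * z.2 i * z.2 j

/-- The components `J_{(2)}^{ij}`. -/
noncomputable def J2 (z : PhaseSpace n) (i j : Fin n) : ℝ :=
  1 / (A * energy G z * lam (energy G z)) * (G z.1)⁻¹ i j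
    + -b₁ (energy G z) / (A * energy G z ^ 2 * lam (energy G z)
        * (A * lam (energy G z) + 2 * b₁ (energy G z))) * pUp G z i * pUp G z j

/-- The components of the horizontal part of the Nijenhuis tensor. -/
noncomputable def nijComp (z : PhaseSpace n) (k i j : Fin n) : ℝ :=
  ∑ h, (CotLift.nijCoeff A lam b₁ (energy G z)
      * (CotLift.kron h i * G z.1 j k - CotLift.kron h j * G z.1 i k)
    - curv G h k i j z.1) * z.2 h

/-! ### Pointwise algebra -/

section Pointwise

variable {G}

theorem sum_metric_mul_inv {x : ModelE n} (h : (G x).PosDef) (i k : Fin n) :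
    ∑ j, G x i j * (G x)⁻¹ j k = if i = k then 1 else 0 := by
  have h1 := Matrix.mul_nonsing_inv (G x) h.det_pos.ne'.isUnit
  have h2 := congrFun (congrFun h1 i) k
  rwa [Matrix.mul_apply, Matrix.one_apply] at h2

theorem metric_symm {x : ModelE n} (h : (G x).PosDef) (i j : Fin n) : G x i j = G x j i := by
  simpa using (h.isHermitian.apply i j).symm

theorem inv_symm {x : ModelE n} (h : (G x).PosDef) (i j : Fin n) :
    (G x)⁻¹ i j = (G x)⁻¹ j i := by
  simpa using (h.inv.isHermitian.apply i j).symm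

theorem sum_metric_mul_pUp {z : PhaseSpace n} (h : (G z.1).PosDef) (i : Fin n) :
    ∑ j, G z.1 i j * pUp G z j = z.2 i := by
  have h1 : ∀ j, G z.1 i j * pUp G z j = ∑ k, z.2 k * (G z.1 i j * (G z.1)⁻¹ j k) := by
    intro j
    rw [pUp, Finset.mul_sum]
    refine Finset.sum_congr rfl fun k _ => ?_
    rw [inv_symm h k j]; ring
  simp_rw [h1]
  rw [Finset.sum_comm]
  simp_rw [← Finset.mul_sum, sum_metric_mul_inv h]
  simp

theorem energy_eq (z : PhaseSpace n) : energy G z = (1 / 2 : ℝ) * ∑ j, pUp G z j * z.2 j := by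
  unfold energy pUp
  rw [Finset.sum_comm]
  congr 1
  refine Finset.sum_congr rfl fun k _ => ?_
  rw [Finset.sum_mul]
  refine Finset.sum_congr rfl fun i _ => ?_
  ring

theorem sum_pUp_mul (z : PhaseSpace n) : ∑ j, pUp G z j * z.2 j = 2 * energy G z := by
  rw [energy_eq]; ring

theorem energy_pos {z : PhaseSpace n} (h : (G z.1).PosDef) (hz : z.2 ≠ 0) : 0 < energy G z := by
  have h0 : (z.2 : Fin n → ℝ) ≠ 0 := fun h0 => hz (by ext i; exact congrFun h0 i)
  have h1 := h.inv.dotProduct_mulVec_pos h0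
  have h2 : energy G z = (1 / 2 : ℝ) * (star (z.2 : Fin n → ℝ) ⬝ᵥ ((G z.1)⁻¹.mulVec z.2)) := by
    simp only [energy, dotProduct, Matrix.mulVec, Finset.mul_sum, star_trivial]
    refine Finset.sum_congr rfl fun i _ => Finset.sum_congr rfl fun k _ => ?_
    ring
  rw [h2]; positivity

/-- Inversion of a rank-one perturbation. With a₁ = Atλ, everything except the identity is a
multiple of p_i g^{0k}, with coefficient a₁b₂ + b₁/a₁ + 2t b₁b₂, where |p|² = 2t was used. The given
b₂ is the one that makes this vanish, and A λ + 2 b₁ enters through a₁ + 2t b₁ = t (A λ + 2 b₁). -/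
theorem sum_J1_mul_J2 {z : PhaseSpace n} (h : (G z.1).PosDef) (hA : A ≠ 0)
    (ht : energy G z ≠ 0) (hl : lam (energy G z) ≠ 0)
    (hb : A * lam (energy G z) + 2 * b₁ (energy G z) ≠ 0) (i k : Fin n) :
    ∑ j, J1 G A lam b₁ z i j * J2 G A lam b₁ z j k = if i = k then 1 else 0 := by
  have e2 := sum_pUp_mul (G := G) z
  have e1 := sum_metric_mul_pUp h i
  have e0 := sum_metric_mul_inv h i k
  have e3 : ∑ j, z.2 j * (G z.1)⁻¹ j k = pUp G z k := rfl
  set t := energy G z with ht'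
  set a1 := A * t * lam t with ha1
  set b2 := -b₁ t / (A * t ^ 2 * lam t * (A * lam t + 2 * b₁ t)) with hb2
  have key : ∀ j, J1 G A lam b₁ z i j * J2 G A lam b₁ z j k =
      (a1 * (1 / a1)) * (G z.1 i j * (G z.1)⁻¹ j k)
      + (a1 * b2 * pUp G z k) * (G z.1 i j * pUp G z j)
      + (b₁ t * z.2 i * (1 / a1)) * (z.2 j * (G z.1)⁻¹ j k)
      + (b₁ t * z.2 i * b2 * pUp G z k) * (pUp G z j * z.2 j) := by
    intro j
    simp only [J1, J2, ← ht', ← hb2, ← ha1]; ring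
  simp_rw [key, Finset.sum_add_distrib, ← Finset.mul_sum, e0, e1, e2, e3]
  have ha : a1 ≠ 0 := by positivity
  have h4 : a1 * b2 + b₁ t * (1 / a1) + b₁ t * b2 * (2 * t) = 0 := by
    have h5 : b2 * (A * lam t + 2 * b₁ t) = -b₁ t / (A * t ^ 2 * lam t) := by
      rw [hb2, div_mul_eq_mul_div, mul_div_mul_right _ _ hb]
    have h6 : t * (b2 * (A * lam t + 2 * b₁ t)) + b₁ t * (1 / a1) = 0 := by
      rw [h5, ha1]; field_simp; ring
    rw [← h6]; ring
  rw [mul_one_div_cancel ha, one_mul]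
  linear_combination z.2 i * pUp G z k * h4

theorem J1_symm {z : PhaseSpace n} (h : (G z.1).PosDef) (i j : Fin n) :
    J1 G A lam b₁ z i j = J1 G A lam b₁ z j i := by
  rw [J1, J1, metric_symm h i j]; ring

theorem J2_symm {z : PhaseSpace n} (h : (G z.1).PosDef) (i j : Fin n) :
    J2 G A lam b₁ z i j = J2 G A lam b₁ z j i := by
  rw [J2, J2, inv_symm h i j]; ring

theorem sum_J2_mul_J1 {z : PhaseSpace n} (h : (G z.1).PosDef) (hA : A ≠ 0)
    (ht : energy G z ≠ 0) (hl : lam (energy G z) ≠ 0)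
    (hb : A * lam (energy G z) + 2 * b₁ (energy G z) ≠ 0) (i k : Fin n) :
    ∑ j, J2 G A lam b₁ z i j * J1 G A lam b₁ z j k = if i = k then 1 else 0 := by
  simp_rw [eq_comm (a := i), ← sum_J1_mul_J2 A lam b₁ h hA ht hl hb k i, J1_symm A lam b₁ h k,
    J2_symm A lam b₁ h i, mul_comm]

/-- Lowering the upper index gives the Christoffel symbols of the first kind. They are free of the
inverse metric, so later cancellations become linear identities in the derivatives of `G`. -/
theorem sum_metric_mul_christoffel {x : ModelE n} (h : (G x).PosDef) (j i k : Fin n) :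
    ∑ l, G x j l * christoffel G l i k x =
      (1 / 2 : ℝ) * (fderiv ℝ (fun y => G y k j) x (stdVec i)
        + fderiv ℝ (fun y => G y i j) x (stdVec k) - fderiv ℝ (fun y => G y i k) x (stdVec j)) := by
  simp only [christoffel, Finset.mul_sum]
  rw [Finset.sum_comm]
  have : ∀ m l, G x j l * ((1 / 2 : ℝ) * ((G x)⁻¹ l m *
      (fderiv ℝ (fun y => G y k m) x (stdVec i) + fderiv ℝ (fun y => G y i m) x (stdVec k)
        - fderiv ℝ (fun y => G y i k) x (stdVec m)))) =
      ((1 / 2 : ℝ) * (fderiv ℝ (fun y => G y k m) x (stdVec i)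
        + fderiv ℝ (fun y => G y i m) x (stdVec k)
        - fderiv ℝ (fun y => G y i k) x (stdVec m))) * (G x j l * (G x)⁻¹ l m) := by
    intros; ring
  simp_rw [this, ← Finset.mul_sum, sum_metric_mul_inv h]
  simp

theorem fderiv_metric_symm {x : ModelE n} (h : ∀ᶠ y in nhds x, (G y).PosDef) (i j : Fin n) :
    fderiv ℝ (fun y => G y i j) x = fderiv ℝ (fun y => G y j i) x :=
  Filter.EventuallyEq.fderiv_eq (h.mono fun _ hy => metric_symm hy i j)

theorem christoffel_symm {x : ModelE n} (h : ∀ᶠ y in nhds x, (G y).PosDef) (k i j : Fin n) :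
    christoffel G k i j x = christoffel G k j i x := by
  simp only [christoffel, fderiv_metric_symm h i j]
  congr 1
  refine Finset.sum_congr rfl fun l _ => ?_
  ring

theorem hor_symm {z : PhaseSpace n} (h : ∀ᶠ y in nhds z.1, (G y).PosDef) (i j : Fin n) :
    hor G i j z = hor G j i z := by
  simp only [hor, christoffel_symm h _ i j]

theorem hor_eq {z : PhaseSpace n} (h : (G z.1).PosDef) (i k : Fin n) :
    hor G i k z = ∑ j, pUp G z j * ((1 / 2 : ℝ) * (fderiv ℝ (fun y => G y k j) z.1 (stdVec i)
        + fderiv ℝ (fun y => G y i j) z.1 (stdVec k)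
        - fderiv ℝ (fun y => G y i k) z.1 (stdVec j))) := by
  simp_rw [← sum_metric_mul_christoffel h, hor, Finset.mul_sum]
  rw [Finset.sum_comm]
  refine Finset.sum_congr rfl fun l _ => ?_
  rw [← sum_metric_mul_pUp h l, Finset.sum_mul]
  refine Finset.sum_congr rfl fun j _ => ?_
  rw [metric_symm h l j]; ring

theorem sum_J1_mul_christoffel {z : PhaseSpace n} (h : (G z.1).PosDef) (i j k : Fin n) :
    ∑ l, J1 G A lam b₁ z i l * christoffel G l j k z.1 =
      A * energy G z * lam (energy G z) *
        ((1 / 2 : ℝ) * (fderiv ℝ (fun y => G y k i) z.1 (stdVec j)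
          + fderiv ℝ (fun y => G y j i) z.1 (stdVec k)
          - fderiv ℝ (fun y => G y j k) z.1 (stdVec i)))
      + b₁ (energy G z) * z.2 i * hor G j k z := by
  rw [← sum_metric_mul_christoffel h, hor, Finset.mul_sum, Finset.mul_sum,
    ← Finset.sum_add_distrib]
  refine Finset.sum_congr rfl fun l _ => ?_
  rw [J1]; ring

/-- The fibre derivative of the energy is contraction with g^{0l}, so this computes the derivative
of t along the vertical field J δ/δq^i. -/
theorem sum_pUp_mul_J1 {z : PhaseSpace n} (h : (G z.1).PosDef) (i : Fin n) :
    ∑ l, pUp G z l * J1 G A lam b₁ z i l =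
      (A * energy G z * lam (energy G z) + 2 * energy G z * b₁ (energy G z)) * z.2 i := by
  have : ∀ l, pUp G z l * J1 G A lam b₁ z i l =
      A * energy G z * lam (energy G z) * (G z.1 i l * pUp G z l)
        + b₁ (energy G z) * z.2 i * (pUp G z l * z.2 l) := by
    intro l; rw [J1]; ring
  simp_rw [this, Finset.sum_add_distrib, ← Finset.mul_sum, sum_metric_mul_pUp h, sum_pUp_mul]
  ring

theorem nijComp_eq (z : PhaseSpace n) (k i j : Fin n) :
    nijComp G A lam b₁ z k i j = CotLift.nijCoeff A lam b₁ (energy G z)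
      * (z.2 i * G z.1 j k - z.2 j * G z.1 i k) - ∑ h, curv G h k i j z.1 * z.2 h := by
  have h1 : ∀ (c : ℝ) (i : Fin n), ∑ h, CotLift.kron h i * c * z.2 h = c * z.2 i := by
    intro c i
    simp [CotLift.kron]
  have h2 : ∀ h, (CotLift.nijCoeff A lam b₁ (energy G z)
      * (CotLift.kron h i * G z.1 j k - CotLift.kron h j * G z.1 i k)
    - curv G h k i j z.1) * z.2 h = CotLift.nijCoeff A lam b₁ (energy G z) *
      (CotLift.kron h i * G z.1 j k * z.2 h - CotLift.kron h j * G z.1 i k * z.2 h)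
      - curv G h k i j z.1 * z.2 h := by intro h; ring
  simp_rw [nijComp, h2, Finset.sum_sub_distrib, ← Finset.mul_sum, Finset.sum_sub_distrib, h1]
  ring

end Pointwise

end CotModel

namespace CotModel

/-! ### Smoothness and first derivatives -/

section Derivatives

variable {n : ℕ} {G : ModelE n → Matrix (Fin n) (Fin n) ℝ} {A : ℝ} {lam b₁ : ℝ → ℝ}

theorem contDiffAt_det {E ι : Type*} [NormedAddCommGroup E] [NormedSpace ℝ E] [Fintype ι]
    [DecidableEq ι] {m : ℕ∞ω} {B : E → Matrix ι ι ℝ} {x : E}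
    (hB : ∀ i j, ContDiffAt ℝ m (fun y => B y i j) x) : ContDiffAt ℝ m (fun y => (B y).det) x := by
  simp only [Matrix.det_apply]
  exact ContDiffAt.sum fun σ _ => ContDiffAt.const_smul _ (contDiffAt_prod fun i _ => hB _ _)

/-- Cramer's rule: an adjugate entry is the determinant of a matrix with one row replaced by a
constant one. -/
theorem contDiffAt_matrix_inv {E ι : Type*} [NormedAddCommGroup E] [NormedSpace ℝ E] [Fintype ι]
    [DecidableEq ι] {m : ℕ∞ω} {B : E → Matrix ι ι ℝ} {x : E}
    (hB : ∀ i j, ContDiffAt ℝ m (fun y => B y i j) x) (h0 : (B x).det ≠ 0) (i j : ι) :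
    ContDiffAt ℝ m (fun y => (B y)⁻¹ i j) x := by
  simp only [Matrix.inv_def, Ring.inverse_eq_inv', Matrix.smul_apply, smul_eq_mul,
    Matrix.adjugate_apply]
  refine ((contDiffAt_det hB).inv h0).mul (contDiffAt_det fun k l => ?_)
  by_cases hk : k = j
  · subst hk
    simpa only [Matrix.updateRow_self] using contDiffAt_const
  · simpa only [Matrix.updateRow_ne hk] using hB k l

theorem differentiableAt_christoffel {x : ModelE n}
    (hG : ∀ i j, ContDiffAt ℝ 2 (fun y => G y i j) x) (hpd : (G x).PosDef) (k i j : Fin n) :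
    DifferentiableAt ℝ (christoffel G k i j) x := by
  have hd : ∀ a b c : Fin n,
      DifferentiableAt ℝ (fun y => fderiv ℝ (fun w => G w a b) y (stdVec c)) x := fun a b c =>
    (((hG a b).fderiv_right (m := 1) (by norm_num)).differentiableAt one_ne_zero).clm_apply
      (differentiableAt_const _)
  have hi : ∀ a b : Fin n, DifferentiableAt ℝ (fun y => (G y)⁻¹ a b) x := fun a b =>
    (contDiffAt_matrix_inv hG hpd.det_pos.ne' a b).differentiableAt two_ne_zero
  unfold christoffel
  exact (DifferentiableAt.fun_sum fun l _ =>
    (hi k l).fun_mul (((hd j l i).add (hd i l j)).sub (hd i j l))).const_mul _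

theorem differentiableAt_comp_fst {f : ModelE n → ℝ} {z : PhaseSpace n}
    (hf : DifferentiableAt ℝ f z.1) : DifferentiableAt ℝ (fun w : PhaseSpace n => f w.1) z :=
  hf.comp z differentiableAt_fst

theorem fderiv_comp_fst {f : ModelE n → ℝ} {z : PhaseSpace n}
    (hf : DifferentiableAt ℝ f z.1) (v : PhaseSpace n) :
    fderiv ℝ (fun w : PhaseSpace n => f w.1) z v = fderiv ℝ f z.1 v.1 := by
  have h := (hf.hasFDerivAt.comp z (hasFDerivAt_fst (p := z))).fderiv
  have h' : fderiv ℝ (fun w : PhaseSpace n => f w.1) z = _ := h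
  rw [h']; rfl

theorem hasFDerivAt_mom (z : PhaseSpace n) (k : Fin n) :
    HasFDerivAt (fun w : PhaseSpace n => w.2 k)
      ((EuclideanSpace.proj k : ModelE n →L[ℝ] ℝ).comp (ContinuousLinearMap.snd ℝ _ _)) z :=
  ((EuclideanSpace.proj k : ModelE n →L[ℝ] ℝ).comp
    (ContinuousLinearMap.snd ℝ (ModelE n) (ModelE n))).hasFDerivAt

theorem differentiableAt_mom (z : PhaseSpace n) (k : Fin n) :
    DifferentiableAt ℝ (fun w : PhaseSpace n => w.2 k) z := (hasFDerivAt_mom z k).differentiableAt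

theorem fderiv_mom (z v : PhaseSpace n) (k : Fin n) :
    fderiv ℝ (fun w : PhaseSpace n => w.2 k) z v = v.2 k := by
  rw [(hasFDerivAt_mom z k).fderiv]; rfl

theorem fderiv_mul_apply {f g : PhaseSpace n → ℝ} {z : PhaseSpace n} (hf : DifferentiableAt ℝ f z)
    (hg : DifferentiableAt ℝ g z) (v : PhaseSpace n) :
    fderiv ℝ (fun w => f w * g w) z v = fderiv ℝ f z v * g z + f z * fderiv ℝ g z v := by
  rw [fderiv_fun_mul hf hg]
  simp; ring

theorem fderiv_sum_apply {f : Fin n → PhaseSpace n → ℝ} {z : PhaseSpace n}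
    (hf : ∀ i, DifferentiableAt ℝ (f i) z) (v : PhaseSpace n) :
    fderiv ℝ (fun w => ∑ i, f i w) z v = ∑ i, fderiv ℝ (f i) z v := by
  rw [fderiv_fun_sum fun i _ => hf i]
  simp

variable {z : PhaseSpace n}

theorem differentiableAt_hor
    (hG : ∀ i j, ContDiffAt ℝ 2 (fun y => G y i j) z.1) (hpd : (G z.1).PosDef) (i h : Fin n) :
    DifferentiableAt ℝ (hor G i h) z :=
  DifferentiableAt.fun_sum fun k _ => (differentiableAt_mom z k).fun_mul
    (differentiableAt_comp_fst (differentiableAt_christoffel hG hpd k i h))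

theorem fderiv_hor
    (hG : ∀ i j, ContDiffAt ℝ 2 (fun y => G y i j) z.1) (hpd : (G z.1).PosDef) (i h : Fin n)
    (v : PhaseSpace n) :
    fderiv ℝ (hor G i h) z v = ∑ k, (v.2 k * christoffel G k i h z.1
      + z.2 k * fderiv ℝ (christoffel G k i h) z.1 v.1) := by
  unfold hor
  rw [fderiv_sum_apply fun k => (differentiableAt_mom z k).fun_mul
    (differentiableAt_comp_fst (differentiableAt_christoffel hG hpd k i h))]
  refine Finset.sum_congr rfl fun k _ => ?_
  rw [fderiv_mul_apply (differentiableAt_mom z k)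
    (differentiableAt_comp_fst (differentiableAt_christoffel hG hpd k i h)), fderiv_mom,
    fderiv_comp_fst (differentiableAt_christoffel hG hpd k i h)]

theorem differentiableAt_pUp
    (hG : ∀ i j, ContDiffAt ℝ 2 (fun y => G y i j) z.1) (hpd : (G z.1).PosDef) (i : Fin n) :
    DifferentiableAt ℝ (fun w => pUp G w i) z :=
  DifferentiableAt.fun_sum fun k _ => (differentiableAt_mom z k).fun_mul
    (differentiableAt_comp_fst ((contDiffAt_matrix_inv hG hpd.det_pos.ne' k i).differentiableAt
      two_ne_zero))

theorem differentiableAt_energy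
    (hG : ∀ i j, ContDiffAt ℝ 2 (fun y => G y i j) z.1) (hpd : (G z.1).PosDef) :
    DifferentiableAt ℝ (energy G) z := by
  rw [funext (energy_eq (G := G))]
  exact (DifferentiableAt.fun_sum fun k _ => (differentiableAt_pUp hG hpd k).fun_mul
    (differentiableAt_mom z k)).const_mul _

/-- The inverse metric is never differentiated. Instead g_{ij} g^{0j} = p_i is differentiated and
contracted with g^{0i}, which gives p_j d(g^{0j}), the unknown part of d(g^{0j} p_j) = 2 dt. -/
theorem fderiv_energy
    (hG : ∀ i j, ContDiffAt ℝ 2 (fun y => G y i j) z.1) (hpd : ∀ᶠ y in nhds z.1, (G y).PosDef)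
    (v : PhaseSpace n) :
    fderiv ℝ (energy G) z v = ∑ l, pUp G z l * v.2 l
      - (1 / 2 : ℝ) * ∑ k, ∑ l, pUp G z k * pUp G z l * fderiv ℝ (fun y => G y k l) z.1 v.1 := by
  have hz := hpd.self_of_nhds
  have hu := fun j => differentiableAt_pUp hG hz j
  have hg := fun i j => differentiableAt_comp_fst ((hG i j).differentiableAt two_ne_zero)
  have hpd' : ∀ᶠ w in nhds z, (G w.1).PosDef := continuousAt_fst.eventually hpd
  have h1 : ∀ i, ∑ j, fderiv ℝ (fun y => G y i j) z.1 v.1 * pUp G z j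
      + ∑ j, G z.1 i j * fderiv ℝ (fun w => pUp G w j) z v = v.2 i := by
    intro i
    have h2 : (fun w : PhaseSpace n => ∑ j, G w.1 i j * pUp G w j) =ᶠ[nhds z] fun w => w.2 i :=
      hpd'.mono fun w hw => sum_metric_mul_pUp hw i
    have h3 := congrArg (fun T => T v) (h2.fderiv_eq (𝕜 := ℝ))
    simp only at h3
    rw [fderiv_sum_apply fun j => (hg i j).fun_mul (hu j), fderiv_mom] at h3
    rw [← h3, ← Finset.sum_add_distrib]
    refine Finset.sum_congr rfl fun j _ => ?_
    rw [fderiv_mul_apply (hg i j) (hu j),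
      fderiv_comp_fst ((hG i j).differentiableAt two_ne_zero)]
  have h4 : fderiv ℝ (energy G) z v = (1 / 2 : ℝ) *
      ∑ j, (fderiv ℝ (fun w => pUp G w j) z v * z.2 j + pUp G z j * v.2 j) := by
    rw [funext (energy_eq (G := G)), fderiv_const_mul (DifferentiableAt.fun_sum fun k _ =>
      (hu k).fun_mul (differentiableAt_mom z k)), smul_apply,
      fderiv_sum_apply fun k => (hu k).fun_mul (differentiableAt_mom z k), smul_eq_mul]
    congr 1
    refine Finset.sum_congr rfl fun j _ => ?_
    rw [fderiv_mul_apply (hu j) (differentiableAt_mom z j), fderiv_mom]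
  have h5 : ∑ j, fderiv ℝ (fun w => pUp G w j) z v * z.2 j =
      ∑ i, pUp G z i * ∑ j, G z.1 i j * fderiv ℝ (fun w => pUp G w j) z v := by
    simp_rw [← sum_metric_mul_pUp hz, Finset.mul_sum]
    rw [Finset.sum_comm]
    refine Finset.sum_congr rfl fun i _ => Finset.sum_congr rfl fun j _ => ?_
    rw [metric_symm hz j i]; ring
  have h6 : ∀ i, ∑ j, G z.1 i j * fderiv ℝ (fun w => pUp G w j) z v =
      v.2 i - ∑ j, fderiv ℝ (fun y => G y i j) z.1 v.1 * pUp G z j := fun i => by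
    rw [← h1 i]; ring
  rw [h4, Finset.sum_add_distrib, h5]
  simp_rw [h6, mul_sub, Finset.sum_sub_distrib, Finset.mul_sum]
  have h7 : ∑ k, ∑ l, pUp G z k * (fderiv ℝ (fun y => G y k l) z.1 v.1 * pUp G z l) =
      ∑ k, ∑ l, pUp G z k * pUp G z l * fderiv ℝ (fun y => G y k l) z.1 v.1 :=
    Finset.sum_congr rfl fun i _ => Finset.sum_congr rfl fun j _ => by ring
  simp_rw [← Finset.mul_sum] at h7 ⊢
  linarith

/-- The energy density is constant along the horizontal distribution. -/
theorem fderiv_energy_hor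
    (hG : ∀ i j, ContDiffAt ℝ 2 (fun y => G y i j) z.1) (hpd : ∀ᶠ y in nhds z.1, (G y).PosDef)
    (i : Fin n) :
    fderiv ℝ (energy G) z (stdVec i, WithLp.toLp 2 fun h => hor G i h z) = 0 := by
  rw [fderiv_energy hG hpd]
  simp only [hor_eq hpd.self_of_nhds, Finset.mul_sum]
  set d : Fin n → Fin n → Fin n → ℝ := fun a b c => fderiv ℝ (fun y => G y b c) z.1 (stdVec a)
    with hd
  set u := pUp G z
  have h1 : ∑ k, ∑ l, u k * (u l * (1 / 2 * (d i k l + d k i l - d l i k))) =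
      (1 / 2) * ((∑ k, ∑ l, u k * u l * d i k l) + (∑ k, ∑ l, u k * u l * d k i l)
        - ∑ k, ∑ l, u k * u l * d l i k) := by
    rw [← Finset.sum_add_distrib, ← Finset.sum_sub_distrib, Finset.mul_sum]
    refine Finset.sum_congr rfl fun k _ => ?_
    rw [← Finset.sum_add_distrib, ← Finset.sum_sub_distrib, Finset.mul_sum]
    refine Finset.sum_congr rfl fun l _ => ?_
    ring
  -- Two of the three terms of the Christoffel symbol cancel against the symmetric product u_k u_l.
  -- The remaining one cancels the base derivative of the energy.
  have h2 : ∑ k, ∑ l, u k * u l * d l i k = ∑ k, ∑ l, u k * u l * d k i l := by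
    rw [Finset.sum_comm]
    refine Finset.sum_congr rfl fun k _ => Finset.sum_congr rfl fun l _ => by ring
  simp only [hd] at h1 h2
  rw [h1, h2]
  simp_rw [← Finset.mul_sum]
  ring

theorem differentiableAt_J1
    (hG : ∀ i j, ContDiffAt ℝ 2 (fun y => G y i j) z.1) (hpd : (G z.1).PosDef)
    (hl : DifferentiableAt ℝ lam (energy G z)) (hb : DifferentiableAt ℝ b₁ (energy G z))
    (i j : Fin n) : DifferentiableAt ℝ (fun w => J1 G A lam b₁ w i j) z := by
  have ht := differentiableAt_energy hG hpd
  exact (((ht.const_mul A).fun_mul (hl.comp z ht)).fun_mul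
    (differentiableAt_comp_fst ((hG i j).differentiableAt two_ne_zero))).add
    (((hb.comp z ht).fun_mul (differentiableAt_mom z i)).fun_mul (differentiableAt_mom z j))

theorem fderiv_comp_energy {f : ℝ → ℝ} (ht : DifferentiableAt ℝ (energy G) z)
    (hf : DifferentiableAt ℝ f (energy G z)) (v : PhaseSpace n) :
    fderiv ℝ (fun w => f (energy G w)) z v = deriv f (energy G z) * fderiv ℝ (energy G) z v := by
  have h := (hf.hasDerivAt.comp_hasFDerivAt z ht.hasFDerivAt).fderiv
  have h' : fderiv ℝ (fun w => f (energy G w)) z = _ := h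
  rw [h']; rfl

theorem fderiv_J1
    (hG : ∀ i j, ContDiffAt ℝ 2 (fun y => G y i j) z.1) (hpd : (G z.1).PosDef)
    (hl : DifferentiableAt ℝ lam (energy G z)) (hb : DifferentiableAt ℝ b₁ (energy G z))
    (i j : Fin n) (v : PhaseSpace n) :
    fderiv ℝ (fun w => J1 G A lam b₁ w i j) z v =
      fderiv ℝ (energy G) z v * (A * (lam (energy G z) + energy G z * deriv lam (energy G z))
        * G z.1 i j + deriv b₁ (energy G z) * z.2 i * z.2 j)
      + A * energy G z * lam (energy G z) * fderiv ℝ (fun y => G y i j) z.1 v.1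
      + b₁ (energy G z) * (v.2 i * z.2 j + z.2 i * v.2 j) := by
  have ht := differentiableAt_energy hG hpd
  have hg := differentiableAt_comp_fst ((hG i j).differentiableAt two_ne_zero)
  have hl' : DifferentiableAt ℝ (fun w => lam (energy G w)) z := hl.comp z ht
  have hb' : DifferentiableAt ℝ (fun w => b₁ (energy G w)) z := hb.comp z ht
  have hA : DifferentiableAt ℝ (fun _ : PhaseSpace n => A) z := differentiableAt_const A
  have hp := differentiableAt_mom z
  unfold J1
  rw [fderiv_fun_add (((hA.fun_mul ht).fun_mul hl').fun_mul hg) ((hb'.fun_mul (hp i)).fun_mul (hp j)), add_apply,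
    fderiv_mul_apply ((hA.fun_mul ht).fun_mul hl') hg, fderiv_mul_apply (hA.fun_mul ht) hl',
    fderiv_mul_apply hA ht, fderiv_mul_apply (hb'.fun_mul (hp i)) (hp j),
    fderiv_mul_apply hb' (hp i), fderiv_comp_energy ht hl, fderiv_comp_energy ht hb,
    fderiv_mom, fderiv_mom, fderiv_comp_fst ((hG i j).differentiableAt two_ne_zero),
    fderiv_fun_const]
  simp
  ring

theorem differentiableAt_J2
    (hG : ∀ i j, ContDiffAt ℝ 2 (fun y => G y i j) z.1) (hpd : (G z.1).PosDef)
    (hl : DifferentiableAt ℝ lam (energy G z)) (hb : DifferentiableAt ℝ b₁ (energy G z))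
    (hA : A ≠ 0) (ht0 : energy G z ≠ 0) (hl0 : lam (energy G z) ≠ 0)
    (hb0 : A * lam (energy G z) + 2 * b₁ (energy G z) ≠ 0)
    (i j : Fin n) : DifferentiableAt ℝ (fun w => J2 G A lam b₁ w i j) z := by
  have ht := differentiableAt_energy hG hpd
  have hi := differentiableAt_comp_fst ((contDiffAt_matrix_inv hG hpd.det_pos.ne' i
    j).differentiableAt two_ne_zero)
  have hl' : DifferentiableAt ℝ (fun w => lam (energy G w)) z := hl.comp z ht
  have hb' : DifferentiableAt ℝ (fun w => b₁ (energy G w)) z := hb.comp z ht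
  have hu := differentiableAt_pUp hG hpd
  unfold J2
  have h1 : A * energy G z * lam (energy G z) ≠ 0 := by positivity
  have h2 : A * energy G z ^ 2 * lam (energy G z)
      * (A * lam (energy G z) + 2 * b₁ (energy G z)) ≠ 0 := mul_ne_zero (by positivity) hb0
  have h0 : DifferentiableAt ℝ (fun w => A * energy G w * lam (energy G w)) z :=
    (ht.const_mul A).fun_mul hl'
  have h3 : DifferentiableAt ℝ (fun w => 1 / (A * energy G w * lam (energy G w))) z :=
    by simpa only [one_div] using h0.fun_inv h1
  have h4 : DifferentiableAt ℝ (fun w => -b₁ (energy G w) / (A * energy G w ^ 2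
      * lam (energy G w) * (A * lam (energy G w) + 2 * b₁ (energy G w)))) z := by
    have h5 : DifferentiableAt ℝ (fun w => A * energy G w ^ 2
        * lam (energy G w) * (A * lam (energy G w) + 2 * b₁ (energy G w))) z :=
      (((ht.fun_pow 2).const_mul A).fun_mul hl').fun_mul
        ((hl'.const_mul A).fun_add (hb'.const_mul 2))
    simpa only [div_eq_mul_inv] using hb'.fun_neg.fun_mul (h5.fun_inv h2)
  exact (h3.fun_mul hi).fun_add ((h4.fun_mul (hu i)).fun_mul (hu j))

end Derivatives

end CotModel

namespace CotModel

variable {n : ℕ} (G : ModelE n → Matrix (Fin n) (Fin n) ℝ) (A : ℝ) (lam b₁ : ℝ → ℝ)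

/-! ### The adapted frame and the almost complex structure on the phase space -/

/-- The vector `a_h ∂/∂p_h`. -/
noncomputable def vert (a : Fin n → ℝ) : PhaseSpace n := (0, WithLp.toLp 2 a)

/-- The horizontal vector `δ/δq^i`. -/
noncomputable def horVec (i : Fin n) (z : PhaseSpace n) : PhaseSpace n :=
  (stdVec i, WithLp.toLp 2 fun h => hor G i h z)

/-- The vector `J (∂/∂p_i)`. -/
noncomputable def imageVert (i : Fin n) (z : PhaseSpace n) : PhaseSpace n :=
  -∑ j, J2 G A lam b₁ z i j • horVec G j z

/-- The operator `J` on the phase space. -/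
noncomputable def Jop (z : PhaseSpace n) : PhaseSpace n →L[ℝ] PhaseSpace n :=
  ∑ i, ((EuclideanSpace.proj i : ModelE n →L[ℝ] ℝ).comp
      (ContinuousLinearMap.fst ℝ (ModelE n) (ModelE n))).smulRight
        (vert (J1 G A lam b₁ z i) - ∑ h, hor G i h z • imageVert G A lam b₁ h z)
    + ∑ h, ((EuclideanSpace.proj h : ModelE n →L[ℝ] ℝ).comp
      (ContinuousLinearMap.snd ℝ (ModelE n) (ModelE n))).smulRight (imageVert G A lam b₁ h z)

theorem vert_eq_sum (a : Fin n → ℝ) :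
    vert a = ∑ h, a h • ((0 : ModelE n), (stdVec h : ModelE n)) := by
  refine Prod.ext ?_ ?_
  · simp [vert, Prod.fst_sum]
  · ext k
    simp [vert, Prod.snd_sum, Pi.single_apply]

theorem horVec_eq (i : Fin n) (z : PhaseSpace n) :
    horVec G i z = ((stdVec i : ModelE n), (0 : ModelE n)) + vert fun h => hor G i h z := by
  simp [horVec, vert]

theorem Jop_apply (z v : PhaseSpace n) : Jop G A lam b₁ z v =
    ∑ i, v.1 i • (vert (J1 G A lam b₁ z i) - ∑ h, hor G i h z • imageVert G A lam b₁ h z)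
      + ∑ h, v.2 h • imageVert G A lam b₁ h z := by
  simp [Jop]

theorem Jop_vert (z : PhaseSpace n) (a : Fin n → ℝ) :
    Jop G A lam b₁ z (vert a) = ∑ h, a h • imageVert G A lam b₁ h z := by
  simp [Jop_apply, vert]

theorem Jop_single (z : PhaseSpace n) (i : Fin n) :
    Jop G A lam b₁ z ((0 : ModelE n), (stdVec i : ModelE n)) = imageVert G A lam b₁ i z := by
  simp [Jop_apply]

/-- `Jop` is defined on the coordinate frame through ∂/∂q^i = δ/δq^i - Γ^0_{ih} ∂/∂p_h. On a
horizontal vector the correction terms cancel. -/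
theorem Jop_horVec (z : PhaseSpace n) (i : Fin n) :
    Jop G A lam b₁ z (horVec G i z) = vert (J1 G A lam b₁ z i) := by
  simp [Jop_apply, horVec]

/-- The adapted frame spans. -/
theorem eq_sum_frame (z v : PhaseSpace n) : v = ∑ i, v.1 i • horVec G i z
    + ∑ h, (v.2 h - ∑ i, v.1 i * hor G i h z) • ((0 : ModelE n), (stdVec h : ModelE n)) := by
  refine Prod.ext ?_ ?_
  · ext k
    simp [Prod.fst_sum, horVec, Pi.single_apply]
  · ext k
    simp [Prod.snd_sum, horVec, Pi.single_apply]

theorem eq_of_eq_on_frame {W : Type*} [AddCommGroup W] [Module ℝ W] (z : PhaseSpace n)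
    {L L' : PhaseSpace n →ₗ[ℝ] W} (h1 : ∀ i, L (horVec G i z) = L' (horVec G i z))
    (h2 : ∀ i, L ((0 : ModelE n), (stdVec i : ModelE n)) =
      L' ((0 : ModelE n), (stdVec i : ModelE n))) (v : PhaseSpace n) : L v = L' v := by
  rw [eq_sum_frame G z v]
  simp only [map_add, map_sum, map_smul, h1, h2]

variable {G A lam b₁}

/-- On the adapted frame this says that the matrices `J1` and `J2` are inverse to each other, on
both sides. -/
theorem Jop_Jop {z : PhaseSpace n} (h : (G z.1).PosDef) (hA : A ≠ 0)
    (ht : energy G z ≠ 0) (hl : lam (energy G z) ≠ 0)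
    (hb : A * lam (energy G z) + 2 * b₁ (energy G z) ≠ 0) (v : PhaseSpace n) :
    Jop G A lam b₁ z (Jop G A lam b₁ z v) = -v := by
  have h1 : ∀ i, Jop G A lam b₁ z (vert (J1 G A lam b₁ z i)) = -horVec G i z := by
    intro i
    simp only [Jop_vert, imageVert, smul_neg, Finset.smul_sum, smul_smul, Finset.sum_neg_distrib]
    rw [Finset.sum_comm]
    simp_rw [← Finset.sum_smul, sum_J1_mul_J2 A lam b₁ h hA ht hl hb]
    simp
  have h2 : ∀ i, Jop G A lam b₁ z (imageVert G A lam b₁ i z) =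
      -((0 : ModelE n), (stdVec i : ModelE n)) := by
    intro i
    simp only [imageVert, map_neg, map_sum, map_smul, Jop_horVec, vert_eq_sum, Finset.smul_sum,
      smul_smul]
    rw [Finset.sum_comm]
    simp_rw [← Finset.sum_smul, sum_J2_mul_J1 A lam b₁ h hA ht hl hb]
    simp
  rw [eq_sum_frame G z v]
  simp only [map_add, map_sum, map_smul, Jop_horVec, Jop_single, h1, h2]
  simp only [smul_neg, Finset.sum_neg_distrib, neg_add]

/-! ### Brackets of the adapted frame -/

theorem differentiableAt_section {c : ModelE n} {a : PhaseSpace n → Fin n → ℝ} {z : PhaseSpace n}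
    (ha : ∀ h, DifferentiableAt ℝ (fun w => a w h) z) :
    DifferentiableAt ℝ (fun w => ((c, WithLp.toLp 2 (a w)) : PhaseSpace n)) z := by
  refine (differentiableAt_const c).prodMk ?_
  rw [differentiableAt_euclidean]
  exact ha

theorem fderiv_section {c : ModelE n} {a : PhaseSpace n → Fin n → ℝ} {z : PhaseSpace n}
    (ha : ∀ h, DifferentiableAt ℝ (fun w => a w h) z) (v : PhaseSpace n) :
    fderiv ℝ (fun w => ((c, WithLp.toLp 2 (a w)) : PhaseSpace n)) z v =
      vert fun h => fderiv ℝ (fun w => a w h) z v := by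
  have hd : DifferentiableAt ℝ (fun w => (WithLp.toLp 2 (a w) : ModelE n)) z := by
    rw [differentiableAt_euclidean]; exact ha
  rw [((hasFDerivAt_const c z).prodMk hd.hasFDerivAt).fderiv]
  refine Prod.ext (by simp [vert]) ?_
  ext h
  have h1 := ((EuclideanSpace.proj h : ModelE n →L[ℝ] ℝ).hasFDerivAt.comp z hd.hasFDerivAt).fderiv
  have h2 : fderiv ℝ (fun w => a w h) z = _ := h1
  simp only [vert, h2]
  rfl

-- Both fields have constant q-components, as all the frame fields and their vertical images do.
-- Hence the bracket is vertical and only the p-components need be differentiated.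
open VectorField in
theorem lieBracket_section {c d : ModelE n} {a b : PhaseSpace n → Fin n → ℝ} {z : PhaseSpace n}
    (ha : ∀ h, DifferentiableAt ℝ (fun w => a w h) z)
    (hb : ∀ h, DifferentiableAt ℝ (fun w => b w h) z) :
    lieBracket ℝ (fun w => ((c, WithLp.toLp 2 (a w)) : PhaseSpace n))
      (fun w => ((d, WithLp.toLp 2 (b w)) : PhaseSpace n)) z =
      vert fun h => fderiv ℝ (fun w => b w h) z (c, WithLp.toLp 2 (a z))
        - fderiv ℝ (fun w => a w h) z (d, WithLp.toLp 2 (b z)) := by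
  rw [lieBracket_eq]
  beta_reduce
  rw [fderiv_section ha, fderiv_section hb]
  refine Prod.ext (by simp [vert]) ?_
  ext h
  simp [vert]

section Brackets

variable {z : PhaseSpace n} (hG : ∀ i j, ContDiffAt ℝ 2 (fun y => G y i j) z.1)
  (hpd : ∀ᶠ y in nhds z.1, (G y).PosDef)

open VectorField

include hG hpd in
/-- The integrability tensor of the horizontal distribution is the curvature. -/
theorem lieBracket_horVec (i j : Fin n) :
    lieBracket ℝ (horVec G i) (horVec G j) z =
      vert fun k => ∑ h, curv G h k i j z.1 * z.2 h := by
  have hz := hpd.self_of_nhds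
  have hd := fun i h => differentiableAt_hor hG hz i h
  refine (lieBracket_section (hd i) (hd j)).trans (congrArg vert (funext fun k => ?_))
  -- Along δ/δq^i the change of the momenta gives the terms quadratic in Γ, and the change of
  -- position gives the derivatives of Γ. Antisymmetrising in i, j yields the curvature.
  have h1 : ∀ i j, fderiv ℝ (fun w => hor G j k w) z (stdVec i, WithLp.toLp 2 fun h => hor G i h z)
      = (∑ h, z.2 h * ∑ l, christoffel G h i l z.1 * christoffel G l j k z.1)
        + ∑ h, z.2 h * fderiv ℝ (christoffel G h j k) z.1 (stdVec i) := by
    intro i j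
    rw [fderiv_hor hG hz, Finset.sum_add_distrib]
    congr 1
    simp only [hor, Finset.sum_mul, Finset.mul_sum]
    rw [Finset.sum_comm]
    exact Finset.sum_congr rfl fun a _ => Finset.sum_congr rfl fun b _ => by ring
  rw [h1, h1]
  simp only [curv, Finset.sum_sub_distrib, add_mul, sub_mul, Finset.sum_add_distrib,
    mul_comm (z.2 _)]
  ring

variable (hl : DifferentiableAt ℝ lam (energy G z)) (hb : DifferentiableAt ℝ b₁ (energy G z))

include hG hpd hl hb

/-- The base point stays fixed, so only t and p vary. The terms with b₁' p_i p_j p_k, with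
J^(1)_{ij} p_k and with b₁² are symmetric in i, j and drop out. What remains has coefficient (Atλ +
2tb₁) A (λ + tλ') - b₁ Atλ, which is F. -/
theorem lieBracket_vert_J1 (i j : Fin n) :
    lieBracket ℝ (fun w => vert (J1 G A lam b₁ w i)) (fun w => vert (J1 G A lam b₁ w j)) z =
      vert fun k => CotLift.nijCoeff A lam b₁ (energy G z)
        * (z.2 i * G z.1 j k - z.2 j * G z.1 i k) := by
  have hz := hpd.self_of_nhds
  have hd := fun i h => differentiableAt_J1 (A := A) hG hz hl hb i h
  refine (lieBracket_section (hd i) (hd j)).trans (congrArg vert (funext fun k => ?_))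
  have h0 : ∀ i, fderiv ℝ (energy G) z ((0 : ModelE n), WithLp.toLp 2 (J1 G A lam b₁ z i)) =
      (A * energy G z * lam (energy G z) + 2 * energy G z * b₁ (energy G z)) * z.2 i := by
    intro i
    rw [fderiv_energy hG hpd, ← sum_pUp_mul_J1 A lam b₁ hz]
    simp
  rw [fderiv_J1 hG hz hl hb, fderiv_J1 hG hz hl hb, h0, h0]
  simp only [map_zero, mul_zero, add_zero]
  rw [J1_symm A lam b₁ hz j i]
  simp only [J1, CotLift.nijCoeff]
  ring

/-- Horizontal constancy of t removes λ' and b₁'. The terms with Atλ cancel because Γ_{i,jk} -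
Γ_{j,ik} = ∂_j g_{ik} - ∂_i g_{jk} for the symbols of the first kind. The terms with b₁ cancel by
the symmetry of Γ^0_{ij}. -/
theorem lieBracket_mixed (i j : Fin n) :
    lieBracket ℝ (fun w => vert (J1 G A lam b₁ w i)) (horVec G j) z
      + lieBracket ℝ (horVec G i) (fun w => vert (J1 G A lam b₁ w j)) z = 0 := by
  have hz := hpd.self_of_nhds
  have hd := fun i h => differentiableAt_J1 (A := A) hG hz hl hb i h
  have hh := fun i h => differentiableAt_hor hG hz i h
  have e1 := lieBracket_section (c := 0) (d := stdVec j) (hd i) (hh j)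
  have e2 := lieBracket_section (c := stdVec i) (d := 0) (hh i) (hd j)
  refine (congrArg₂ (· + ·) e1 e2).trans ?_
  have h0 : ∀ i j k, fderiv ℝ (hor G j k) z ((0 : ModelE n), WithLp.toLp 2 (J1 G A lam b₁ z i)) =
      ∑ l, J1 G A lam b₁ z i l * christoffel G l j k z.1 := by
    intro i j k
    rw [fderiv_hor hG hz]
    simp
  have e3 : ∀ k, (fderiv ℝ (hor G j k) z ((0 : ModelE n), WithLp.toLp 2 (J1 G A lam b₁ z i))
      - fderiv ℝ (fun w => J1 G A lam b₁ w i k) z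
        ((stdVec j : ModelE n), WithLp.toLp 2 fun h => hor G j h z))
      + (fderiv ℝ (fun w => J1 G A lam b₁ w j k) z
        ((stdVec i : ModelE n), WithLp.toLp 2 fun h => hor G i h z)
      - fderiv ℝ (hor G i k) z ((0 : ModelE n), WithLp.toLp 2 (J1 G A lam b₁ z j))) = 0 := by
    intro k
    rw [h0, h0, fderiv_J1 hG hz hl hb, fderiv_J1 hG hz hl hb, fderiv_energy_hor hG hpd,
      fderiv_energy_hor hG hpd, sum_J1_mul_christoffel A lam b₁ hz,
      sum_J1_mul_christoffel A lam b₁ hz]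
    simp only [hor_symm hpd j i, fderiv_metric_symm hpd k i, fderiv_metric_symm hpd k j,
      fderiv_metric_symm hpd j i]
    ring
  refine Prod.ext (by simp [vert]) ?_
  ext k
  exact e3 k

end Brackets

end CotModel

namespace CotModel

open VectorField

/-! ### The Nijenhuis tensor of `Jop` on the adapted frame. -/

section NijenhuisOfJop

variable {n : ℕ} {G : ModelE n → Matrix (Fin n) (Fin n) ℝ} {A : ℝ} {lam b₁ : ℝ → ℝ}

theorem differentiableAt_horVec {z : PhaseSpace n}
    (hG : ∀ i j, ContDiffAt ℝ 2 (fun y => G y i j) z.1) (hpd : (G z.1).PosDef) (i : Fin n) :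
    DifferentiableAt ℝ (horVec G i) z :=
  differentiableAt_section fun h => differentiableAt_hor hG hpd i h

theorem differentiableAt_smulRight {L : PhaseSpace n →L[ℝ] ℝ} {f : PhaseSpace n → PhaseSpace n}
    {z : PhaseSpace n} (hf : DifferentiableAt ℝ f z) :
    DifferentiableAt ℝ (fun w => L.smulRight (f w)) z :=
  ((ContinuousLinearMap.smulRightL ℝ (PhaseSpace n) (PhaseSpace n)) L).differentiableAt.comp z hf

theorem differentiableAt_Jop {z : PhaseSpace n}
    (hG : ∀ i j, ContDiffAt ℝ 2 (fun y => G y i j) z.1) (hpd : (G z.1).PosDef)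
    (hl : DifferentiableAt ℝ lam (energy G z)) (hb : DifferentiableAt ℝ b₁ (energy G z))
    (hA : A ≠ 0) (ht0 : energy G z ≠ 0) (hl0 : lam (energy G z) ≠ 0)
    (hb0 : A * lam (energy G z) + 2 * b₁ (energy G z) ≠ 0) :
    DifferentiableAt ℝ (Jop G A lam b₁) z := by
  have h1 : ∀ i, DifferentiableAt ℝ (imageVert G A lam b₁ i) z := fun i =>
    (DifferentiableAt.fun_sum fun j _ => (differentiableAt_J2 hG hpd hl hb hA ht0 hl0 hb0 i j).smul
      (differentiableAt_horVec hG hpd j)).neg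
  have h2 : ∀ i, DifferentiableAt ℝ (fun w => vert (J1 G A lam b₁ w i)) z := fun i =>
    differentiableAt_section fun h => differentiableAt_J1 hG hpd hl hb i h
  unfold Jop
  refine (DifferentiableAt.fun_sum fun i _ => differentiableAt_smulRight ((h2 i).sub
    (DifferentiableAt.fun_sum fun h _ => (differentiableAt_hor hG hpd i h).smul (h1 h)))).add
    (DifferentiableAt.fun_sum fun h _ => differentiableAt_smulRight (h1 h))

/-- The functions `λ`, `b₁` are admissible at `t`. -/
structure Admissible (A : ℝ) (lam b₁ : ℝ → ℝ) (t : ℝ) : Prop where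
  energy_ne : t ≠ 0
  lam_ne : lam t ≠ 0
  comb_ne : A * lam t + 2 * b₁ t ≠ 0

theorem nijComp_swap (z : PhaseSpace n) (k i j : Fin n) :
    nijComp G A lam b₁ z k i j = -nijComp G A lam b₁ z k j i := by
  have h : ∀ i j h, curv G h k i j z.1 = -curv G h k j i z.1 := by
    intro i j h
    simp only [curv, Finset.sum_sub_distrib]; ring
  rw [nijComp_eq, nijComp_eq]
  simp only [h i j, neg_mul, Finset.sum_neg_distrib]
  ring

variable {z : PhaseSpace n} (hG : ∀ i j, ContDiffAt ℝ 2 (fun y => G y i j) z.1)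
  (hpd : ∀ᶠ y in nhds z.1, (G y).PosDef)
  (hl : DifferentiableAt ℝ lam (energy G z)) (hb : DifferentiableAt ℝ b₁ (energy G z))
  (hA : A ≠ 0) (had : ∀ᶠ w in nhds z, Admissible A lam b₁ (energy G w))

include hpd hA had in
theorem eventually_Jop_Jop :
    ∀ᶠ w in nhds z, ∀ v, Jop G A lam b₁ w (Jop G A lam b₁ w v) = -v := by
  have hpd' : ∀ᶠ w in nhds z, (G w.1).PosDef := continuousAt_fst.eventually hpd
  filter_upwards [hpd', had] with w h1 h2 v
  exact Jop_Jop h1 hA h2.energy_ne h2.lam_ne h2.comb_ne v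

-- J applied to both sides of J ∂/∂p_j = -J_(2)^{jr} δ/δq^r. Vertical arguments of N are thereby
-- J-images of horizontal ones.
include hpd hA had in
theorem single_eq_Jop (j : Fin n) : ((0 : ModelE n), (stdVec j : ModelE n)) =
    Jop G A lam b₁ z (∑ r, J2 G A lam b₁ z j r • horVec G r z) := by
  rw [← neg_neg ((0 : ModelE n), (stdVec j : ModelE n)),
    ← (eventually_Jop_Jop hpd hA had).self_of_nhds, map_neg (Jop G A lam b₁ z), Jop_single, imageVert,
    neg_neg]

include hG hpd hl hb hA had

theorem nijenhuisForm_hor_hor (i j : Fin n) :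
    nijenhuisForm (Jop G A lam b₁) z (horVec G i z) (horVec G j z) =
      vert fun k => nijComp G A lam b₁ z k i j := by
  have hz := hpd.self_of_nhds
  have ha := had.self_of_nhds
  have hJ := differentiableAt_Jop hG hz hl hb hA ha.energy_ne ha.lam_ne ha.comb_ne
  rw [← lieBracket_eq_nijenhuisForm hJ (eventually_Jop_Jop hpd hA had).self_of_nhds
    (differentiableAt_horVec hG hz i) (differentiableAt_horVec hG hz j)]
  simp only [Jop_horVec]
  -- The two mixed brackets do not vanish separately in general, so they are first collected under a
  -- single J.
  rw [sub_sub _ (Jop G A lam b₁ z _) (Jop G A lam b₁ z _), ← map_add,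
    lieBracket_mixed hG hpd hl hb, map_zero, sub_zero, lieBracket_vert_J1 hG hpd hl hb,
    lieBracket_horVec hG hpd]
  simp only [nijComp_eq]
  refine Prod.ext (by simp [vert]) ?_
  ext k
  simp [vert]

/-- Here N(δ/δq^i, ∂/∂p_j) = -J_(2)^{jr} J N(δ/δq^i, δ/δq^r). Applying J to the vertical value
contributes another -J_(2)^{lk}, so the signs cancel. -/
theorem nijenhuisForm_hor_vert (i j : Fin n) :
    nijenhuisForm (Jop G A lam b₁) z (horVec G i z) ((0 : ModelE n), (stdVec j : ModelE n)) =
      ∑ k, (∑ l, ∑ r, J2 G A lam b₁ z k l * J2 G A lam b₁ z j r * nijComp G A lam b₁ z l i r) •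
        horVec G k z := by
  have hz := hpd.self_of_nhds
  have ha := had.self_of_nhds
  have hJ := differentiableAt_Jop hG hz hl hb hA ha.energy_ne ha.lam_ne ha.comb_ne
  rw [single_eq_Jop hpd hA had,
    nijenhuisForm_apply_right hJ (eventually_Jop_Jop hpd hA had), nijenhuisForm_sum_smul_right]
  simp only [nijenhuisForm_hor_hor hG hpd hl hb hA had, map_sum, map_smul, Jop_vert, imageVert,
    smul_neg, Finset.sum_neg_distrib, neg_neg, Finset.smul_sum, smul_smul, Finset.sum_smul]
  rw [Finset.sum_comm]
  have h1 : ∀ l, ∑ r, ∑ k, (J2 G A lam b₁ z j r *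
      (nijComp G A lam b₁ z l i r * J2 G A lam b₁ z l k)) • horVec G k z =
      ∑ k, ∑ r, (J2 G A lam b₁ z k l * J2 G A lam b₁ z j r * nijComp G A lam b₁ z l i r) •
        horVec G k z := by
    intro l
    rw [Finset.sum_comm]
    refine Finset.sum_congr rfl fun k _ => Finset.sum_congr rfl fun r _ => ?_
    rw [J2_symm A lam b₁ hz k l]
    congr 1; ring
  simp_rw [h1]
  rw [Finset.sum_comm]

theorem nijenhuisForm_vert_vert (i j : Fin n) :
    nijenhuisForm (Jop G A lam b₁) z ((0 : ModelE n), (stdVec i : ModelE n))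
      ((0 : ModelE n), (stdVec j : ModelE n)) =
      vert fun k => ∑ r, ∑ l, J2 G A lam b₁ z i r * J2 G A lam b₁ z j l *
        nijComp G A lam b₁ z k l r := by
  have hz := hpd.self_of_nhds
  have ha := had.self_of_nhds
  have hJ := differentiableAt_Jop hG hz hl hb hA ha.energy_ne ha.lam_ne ha.comb_ne
  have hJJ := eventually_Jop_Jop hpd hA had
  rw [single_eq_Jop hpd hA had i, single_eq_Jop hpd hA had j,
    nijenhuisForm_apply_left hJ hJJ, nijenhuisForm_apply_right hJ hJJ, map_neg, hJJ.self_of_nhds,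
    neg_neg, nijenhuisForm_sum_smul_left]
  simp only [nijenhuisForm_sum_smul_right, nijenhuisForm_hor_hor hG hpd hl hb hA had]
  refine Prod.ext (by simp [vert, Prod.fst_sum]) ?_
  ext k
  simp only [vert, Prod.snd_neg, Prod.snd_sum, Prod.smul_snd, PiLp.neg_apply, WithLp.ofLp_sum,
    Finset.sum_apply, PiLp.smul_apply, smul_eq_mul, Finset.mul_sum]
  rw [← Finset.sum_neg_distrib]
  refine Finset.sum_congr rfl fun r _ => ?_
  rw [← Finset.sum_neg_distrib]
  refine Finset.sum_congr rfl fun l _ => ?_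
  -- The minus sign of N(Ju,Jv) = -N(u,v) is absorbed by exchanging the last two indices.
  rw [nijComp_swap z k l r]
  ring

end NijenhuisOfJop

end CotModel

namespace CotLift

/-! ### Smoothness of the metric components and of the induced chart. -/

section Smoothness

variable {n : ℕ} {M : Type*} [TopologicalSpace M] [ChartedSpace (ModelE n) M]
  [IsManifold 𝓘(ℝ, ModelE n) ∞ M] {g : RMetric n M} {φ : OpenPartialHomeomorph M (ModelE n)}
  (hφ : φ ∈ IsManifold.maximalAtlas 𝓘(ℝ, ModelE n) ∞ M)

include hφ

omit [IsManifold 𝓘(ℝ, ModelE n) ∞ M] in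
theorem isInvertible_mfderiv_chart {x : M} (hx : x ∈ φ.source) :
    (mfderiv 𝓘(ℝ, ModelE n) 𝓘(ℝ, ModelE n) φ x).IsInvertible := by
  have h : φ.MDifferentiable 𝓘(ℝ, ModelE n) 𝓘(ℝ, ModelE n) :=
    ⟨(contMDiffOn_of_mem_maximalAtlas hφ).mdifferentiableOn (by simp),
      (contMDiffOn_symm_of_mem_maximalAtlas hφ).mdifferentiableOn (by simp)⟩
  exact ⟨h.mfderiv hx, rfl⟩

theorem contMDiffAt_coordVec {x : M} (hx : x ∈ φ.source) (i : Fin n) :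
    ContMDiffAt 𝓘(ℝ, ModelE n) 𝓘(ℝ, ModelE n).tangent ∞
      (fun y => (⟨y, coordVec φ i y⟩ : TangentBundle 𝓘(ℝ, ModelE n) M)) x := by
  have : IsManifold 𝓘(ℝ, ModelE n) 1 M := IsManifold.of_le (n := ∞) (by simp)
  exact ContMDiffAt.mpullback_vectorField_preimage (n := ∞)
    (contMDiffAt_vectorSpace_iff_contDiffAt.2 contDiffAt_const)
    (contMDiffAt_of_mem_maximalAtlas hφ hx) (isInvertible_mfderiv_chart hφ hx) (by simp)

theorem contMDiffAt_gLow {x : M} (hx : x ∈ φ.source) (i j : Fin n) :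
    ContMDiffAt 𝓘(ℝ, ModelE n) 𝓘(ℝ, ℝ) ∞ (fun y => gLow g φ y i j) x := by
  have h : ContMDiffAt 𝓘(ℝ, ModelE n) (𝓘(ℝ, ModelE n).prod 𝓘(ℝ, ℝ)) ∞
      (fun y => Bundle.TotalSpace.mk' ℝ (E := Bundle.Trivial M ℝ) y
        (g.inner y (coordVec φ i y) (coordVec φ j y))) x :=
    ContMDiffAt.clm_bundle_apply₂ (F₁ := ModelE n) (F₂ := ModelE n) g.contMDiff.contMDiffAt
      (contMDiffAt_coordVec hφ hx i) (contMDiffAt_coordVec hφ hx j)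
  rw [Bundle.contMDiffAt_totalSpace] at h
  exact h.2

/-- p_i is the pairing of the tautological section Q ↦ Q.2 along the projection with a coordinate
field. The smoothness of that section is the smoothness of the identity of T*M. -/
theorem contMDiffAt_pLow {P : Cotangent n M} (hP : P.1 ∈ φ.source) (i : Fin n) :
    ContMDiffAt (modCot n) 𝓘(ℝ, ℝ) ∞ (fun Q : Cotangent n M => pLow φ Q i) P := by
  have hproj : ContMDiff (modCot n) 𝓘(ℝ, ModelE n) ∞ (fun Q : Cotangent n M => Q.1) :=
    Bundle.contMDiff_proj (fun x : M => TangentSpace 𝓘(ℝ, ModelE n) x →L[ℝ] ℝ)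
  have h : ContMDiffAt (modCot n) (𝓘(ℝ, ModelE n).prod 𝓘(ℝ, ℝ)) ∞
      (fun Q : Cotangent n M => Bundle.TotalSpace.mk' ℝ (E := Bundle.Trivial M ℝ) Q.1
        (Q.2 (coordVec φ i Q.1))) P :=
    ContMDiffAt.clm_bundle_apply (F₁ := ModelE n) (F₂ := ℝ)
      (E₁ := fun x : M => TangentSpace 𝓘(ℝ, ModelE n) x) (E₂ := Bundle.Trivial M ℝ)
      (b := fun Q : Cotangent n M => Q.1) (ϕ := fun Q : Cotangent n M => Q.2) contMDiffAt_id
      ((contMDiffAt_coordVec hφ hP i).comp P hproj.contMDiffAt)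
  rw [Bundle.contMDiffAt_totalSpace] at h
  exact h.2

theorem contMDiffAt_inducedChart {P : Cotangent n M} (hP : P.1 ∈ φ.source) :
    ContMDiffAt (modCot n) 𝓘(ℝ, ModelE n × ModelE n) ∞ (inducedChart φ) P := by
  have hproj : ContMDiff (modCot n) 𝓘(ℝ, ModelE n) ∞ (fun Q : Cotangent n M => Q.1) :=
    Bundle.contMDiff_proj (fun x : M => TangentSpace 𝓘(ℝ, ModelE n) x →L[ℝ] ℝ)
  refine ContMDiffAt.prodMk_space
    ((contMDiffAt_of_mem_maximalAtlas hφ hP).comp P hproj.contMDiffAt) ?_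
  have h1 : ContMDiffAt (modCot n) 𝓘(ℝ, Fin n → ℝ) ∞ (fun Q : Cotangent n M => pLow φ Q) P :=
    contMDiffAt_pi_space.2 fun i => contMDiffAt_pLow hφ hP i
  exact ((EuclideanSpace.equiv (Fin n) ℝ).symm : (Fin n → ℝ) →L[ℝ] ModelE n).contMDiff.contMDiffAt.comp
    P h1

end Smoothness

end CotLift

namespace CotLift

variable {n : ℕ} {M : Type*} [TopologicalSpace M] [ChartedSpace (ModelE n) M]
  [IsManifold 𝓘(ℝ, ModelE n) ∞ M]

/-! ### The components in the induced chart -/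

section Components

variable (g : RMetric n M) (φ : OpenPartialHomeomorph M (ModelE n))

/-- The matrix of the metric as a function of the coordinates. -/
noncomputable def chartMetric (y : ModelE n) : Matrix (Fin n) (Fin n) ℝ := gLow g φ (φ.symm y)

variable {φ}

theorem chartMetric_apply {x : M} (hx : x ∈ φ.source) : chartMetric g φ (φ x) = gLow g φ x := by
  rw [chartMetric, φ.left_inv hx]

theorem christoffel_eq {x : M} (hx : x ∈ φ.source) (k i j : Fin n) :
    christoffel g φ k i j x = CotModel.christoffel (chartMetric g φ) k i j (φ x) := by
  simp only [christoffel, CotModel.christoffel, chartMetric_apply g hx, gUp]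
  rfl

theorem curv_eq {x : M} (hx : x ∈ φ.source) (h k i j : Fin n) :
    curv g φ h k i j x = CotModel.curv (chartMetric g φ) h k i j (φ x) := by
  have h1 : ∀ a b c d : Fin n, pderiv φ d (christoffel g φ a b c) x =
      fderiv ℝ (CotModel.christoffel (chartMetric g φ) a b c) (φ x) (stdVec d) := by
    intro a b c d
    -- A derivative is taken, so agreement is needed on the whole chart target and not only at the
    -- point.
    have h2 : (fun y => christoffel g φ a b c (φ.symm y)) =ᶠ[nhds (φ x)]
        CotModel.christoffel (chartMetric g φ) a b c := by
      filter_upwards [φ.open_target.mem_nhds (φ.map_source hx)] with y hy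
      rw [christoffel_eq g (φ.map_target hy), φ.right_inv hy]
    rw [pderiv, h2.fderiv_eq]
  simp only [curv, CotModel.curv, h1, christoffel_eq g hx]

variable {P : Cotangent n M} (hP : P.1 ∈ φ.source)

include hP

theorem pUp_eq (i : Fin n) :
    pUp g φ P i = CotModel.pUp (chartMetric g φ) (inducedChart φ P) i := by
  simp only [pUp, CotModel.pUp, inducedChart, chartMetric_apply g hP, gUp]

theorem energy_eq : energy g φ P = CotModel.energy (chartMetric g φ) (inducedChart φ P) := by
  simp only [energy, CotModel.energy, inducedChart, chartMetric_apply g hP, gUp]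

variable (A : ℝ) (lam b₁ : ℝ → ℝ)

theorem J1_eq (i j : Fin n) :
    J1 g φ A lam b₁ P i j = CotModel.J1 (chartMetric g φ) A lam b₁ (inducedChart φ P) i j := by
  rw [J1, CotModel.J1, energy_eq g hP]
  simp only [inducedChart, chartMetric_apply g hP]

theorem J2_eq (i j : Fin n) :
    J2 g φ A lam b₁ P i j = CotModel.J2 (chartMetric g φ) A lam b₁ (inducedChart φ P) i j := by
  rw [J2, CotModel.J2, energy_eq g hP, pUp_eq g hP, pUp_eq g hP]
  simp only [inducedChart, chartMetric_apply g hP, gUp]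

theorem nijComp_eq (k i j : Fin n) : nijComp g φ A lam b₁ P k i j =
    CotModel.nijComp (chartMetric g φ) A lam b₁ (inducedChart φ P) k i j := by
  rw [nijComp, CotModel.nijComp, energy_eq g hP]
  simp only [inducedChart, chartMetric_apply g hP, curv_eq g hP]

end Components

/-! ### Positivity -/

section Positivity

variable (g : RMetric n M) {φ : OpenPartialHomeomorph M (ModelE n)}
  (hφ : φ ∈ IsManifold.maximalAtlas 𝓘(ℝ, ModelE n) ∞ M)

theorem euclidean_eq_sum (c : ModelE n) : c = ∑ i, c i • (stdVec i : ModelE n) := by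
  ext k
  simp [Pi.single_apply]

include hφ

omit [IsManifold 𝓘(ℝ, ModelE n) ∞ M] in
/-- The coordinate vectors are a basis of the tangent space. -/
theorem exists_equiv_coordVec {x : M} (hx : x ∈ φ.source) :
    ∃ e : TangentSpace 𝓘(ℝ, ModelE n) x ≃L[ℝ] ModelE n,
      ∀ c : ModelE n, e.symm c = ∑ i, c i • coordVec φ i x := by
  obtain ⟨e, he⟩ := isInvertible_mfderiv_chart hφ hx
  let e' : TangentSpace 𝓘(ℝ, ModelE n) x ≃L[ℝ] ModelE n := e
  have h1 : ∀ i, coordVec φ i x = e'.symm (stdVec i : ModelE n) := by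
    intro i
    have h2 : coordVec φ i x = (mfderiv 𝓘(ℝ, ModelE n) 𝓘(ℝ, ModelE n) φ x).inverse
      (stdVec i : ModelE n) := rfl
    rw [h2, ← he]
    exact congrArg (fun T => T (stdVec i : ModelE n)) (ContinuousLinearMap.inverse_equiv e')
  refine ⟨e', fun c => ?_⟩
  simp only [h1]
  conv_lhs => rw [euclidean_eq_sum c]
  rw [map_sum]
  simp only [map_smul]

theorem posDef_gLow {x : M} (hx : x ∈ φ.source) : (gLow g φ x).PosDef := by
  refine Matrix.PosDef.of_dotProduct_mulVec_pos ?_ fun c hc => ?_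
  · ext i j
    simp [gLow, g.symm x (coordVec φ i x)]
  · obtain ⟨e, he⟩ := exists_equiv_coordVec hφ hx
    have h0 : e.symm (WithLp.toLp 2 c) ≠ 0 := fun h =>
      hc (congrArg WithLp.ofLp ((map_eq_zero_iff e.symm e.symm.injective).1 h))
    have h := g.pos x _ h0
    rw [he] at h
    simp only [map_sum, map_smul, sum_apply, smul_apply, smul_eq_mul] at h
    simp only [dotProduct, Matrix.mulVec, gLow, Matrix.of_apply, star_trivial]
    simp only [Finset.mul_sum] at h ⊢
    refine h.trans_eq (Finset.sum_congr rfl fun i _ => Finset.sum_congr rfl fun j _ => ?_)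
    rw [g.symm x (coordVec φ i x)]
    ring

theorem pLow_ne_zero {P : Cotangent n M} (hP : P.1 ∈ φ.source) (h0 : P.2 ≠ 0) :
    (inducedChart φ P).2 ≠ 0 := by
  intro h
  refine h0 (ContinuousLinearMap.ext fun v => ?_)
  obtain ⟨e, he⟩ := exists_equiv_coordVec hφ hP
  have h1 : ∀ i, P.2 (coordVec φ i P.1) = 0 := fun i => congrFun (congrArg WithLp.ofLp h) i
  rw [← e.symm_apply_apply v, he, map_sum]
  simp [h1]

theorem contDiffAt_chartMetric {x : M} (hx : x ∈ φ.source) (i j : Fin n) :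
    ContDiffAt ℝ 2 (fun y => chartMetric g φ y i j) (φ x) := by
  have h1 := contMDiffAt_symm_of_mem_maximalAtlas hφ (φ.map_source hx)
  have h2 : ContMDiffAt 𝓘(ℝ, ModelE n) 𝓘(ℝ, ℝ) ∞ (fun y => gLow g φ y i j) (φ.symm (φ x)) :=
    contMDiffAt_gLow hφ (by rwa [φ.left_inv hx]) i j
  exact ((h2.comp (φ x) h1).contDiffAt).of_le (WithTop.coe_le_coe.2 le_top)

theorem eventually_posDef_chartMetric {x : M} (hx : x ∈ φ.source) :
    ∀ᶠ y in nhds (φ x), (chartMetric g φ y).PosDef := by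
  filter_upwards [φ.open_target.mem_nhds (φ.map_source hx)] with y hy
  exact posDef_gLow g hφ (φ.map_target hy)

end Positivity

/-! ### Transfer of the Nijenhuis tensor to the induced chart -/

section Transfer

variable {g : RMetric n M} {φ : OpenPartialHomeomorph M (ModelE n)}

/-- The tangent vector with components `v` in the induced chart. -/
noncomputable def ofComponents (φ : OpenPartialHomeomorph M (ModelE n)) (P : Cotangent n M) :
    PhaseSpace n →L[ℝ] TangentSpace (modCot n) P :=
  (mfderiv (modCot n) 𝓘(ℝ, ModelE n × ModelE n) (inducedChart φ) P).inverse

theorem ofComponents_add (P : Cotangent n M) (v w : PhaseSpace n) :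
    ofComponents φ P (v + w) = ofComponents φ P v + ofComponents φ P w :=
  (ofComponents φ P).map_add v w

theorem ofComponents_sub (P : Cotangent n M) (v w : PhaseSpace n) :
    ofComponents φ P (v - w) = ofComponents φ P v - ofComponents φ P w :=
  (ofComponents φ P).map_sub v w

theorem ofComponents_neg (P : Cotangent n M) (v : PhaseSpace n) :
    ofComponents φ P (-v) = -ofComponents φ P v :=
  (ofComponents φ P).map_neg v

theorem ofComponents_smul (P : Cotangent n M) (c : ℝ) (v : PhaseSpace n) :
    ofComponents φ P (c • v) = c • ofComponents φ P v :=
  (ofComponents φ P).map_smul c v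

theorem ofComponents_sum {ι : Type*} (s : Finset ι) (P : Cotangent n M) (v : ι → PhaseSpace n) :
    ofComponents φ P (∑ i ∈ s, v i) = ∑ i ∈ s, ofComponents φ P (v i) :=
  map_sum (ofComponents φ P).toLinearMap v s

theorem dp_eq (i : Fin n) (P : Cotangent n M) :
    dp φ i P = ofComponents φ P ((0 : ModelE n), (stdVec i : ModelE n)) := rfl

theorem deltaq_eq {P : Cotangent n M} (hP : P.1 ∈ φ.source) (i : Fin n) :
    deltaq g φ i P =
      ofComponents φ P (CotModel.horVec (chartMetric g φ) i (inducedChart φ P)) := by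
  rw [CotModel.horVec_eq, CotModel.vert_eq_sum, ofComponents_add, ofComponents_sum]
  simp only [ofComponents_smul, ← dp_eq, deltaq, christoffel_eq g hP]
  rfl

theorem ofComponents_vert (P : Cotangent n M) (a : Fin n → ℝ) :
    ofComponents φ P (CotModel.vert a) = ∑ k, a k • dp φ k P := by
  rw [CotModel.vert_eq_sum, ofComponents_sum]
  simp only [ofComponents_smul, dp_eq]

variable {A : ℝ} {lam b₁ : ℝ → ℝ}
  {J : (P : Cotangent n M) → TangentSpace (modCot n) P →L[ℝ] TangentSpace (modCot n) P}
  (hJ : IsDiagonalStructure g φ A lam b₁ J)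

include hJ

/-- Both sides are linear in `v` and agree on the adapted frame, which spans the phase space. This
identifies `J` in the chart with `Jop`. -/
theorem apply_ofComponents {P : Cotangent n M} (hP : P.1 ∈ φ.source) (h0 : P.2 ≠ 0)
    (v : PhaseSpace n) : J P (ofComponents φ P v) =
      ofComponents φ P (CotModel.Jop (chartMetric g φ) A lam b₁ (inducedChart φ P) v) := by
  have h1 : ∀ i, J P (ofComponents φ P (CotModel.horVec (chartMetric g φ) i (inducedChart φ P))) =
      ofComponents φ P (CotModel.Jop (chartMetric g φ) A lam b₁ (inducedChart φ P)
        (CotModel.horVec (chartMetric g φ) i (inducedChart φ P))) := by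
    intro i
    rw [← deltaq_eq hP, (hJ P hP h0 i).1, CotModel.Jop_horVec, ofComponents_vert]
    simp only [J1_eq g hP]
  have h2 : ∀ i, J P (ofComponents φ P ((0 : ModelE n), (stdVec i : ModelE n))) =
      ofComponents φ P (CotModel.Jop (chartMetric g φ) A lam b₁ (inducedChart φ P)
        ((0 : ModelE n), (stdVec i : ModelE n))) := by
    intro i
    rw [← dp_eq, (hJ P hP h0 i).2, CotModel.Jop_single, CotModel.imageVert, ofComponents_neg,
      ofComponents_sum]
    simp only [ofComponents_smul, J2_eq g hP, deltaq_eq hP]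
  exact CotModel.eq_of_eq_on_frame (chartMetric g φ) (inducedChart φ P)
    (L := (J P).toLinearMap ∘ₗ (ofComponents φ P).toLinearMap)
    (L' := (ofComponents φ P).toLinearMap ∘ₗ
      (CotModel.Jop (chartMetric g φ) A lam b₁ (inducedChart φ P)).toLinearMap) h1 h2 v

end Transfer

end CotLift

/-! ### Lie brackets and the Nijenhuis tensor read in the induced chart. -/

namespace CotLift

variable {n : ℕ} {M : Type*} [TopologicalSpace M] [ChartedSpace (ModelE n) M]
  [IsManifold 𝓘(ℝ, ModelE n) ∞ M]

theorem mdifferentiableAt_vectorField {E : Type*} [NormedAddCommGroup E] [NormedSpace ℝ E]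
    {V : E → E} {x : E} (hV : DifferentiableAt ℝ V x) :
    MDifferentiableAt 𝓘(ℝ, E) 𝓘(ℝ, E).tangent
      (fun y => (⟨y, V y⟩ : TangentBundle 𝓘(ℝ, E) E)) x := by
  apply (mdifferentiableAt_totalSpace _ _).2
  refine ⟨mdifferentiableAt_id, ?_⟩
  convert! hV.mdifferentiableAt with y
  simp

-- Naturality of the bracket under pullback. Only smoothness of the induced chart is supplied:
-- `mpullback_mlieBracket` does not ask that its derivative be invertible.
open VectorField in
theorem mlieBracket_ofComponents {φ : OpenPartialHomeomorph M (ModelE n)}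
    (hφ : φ ∈ IsManifold.maximalAtlas 𝓘(ℝ, ModelE n) ∞ M) {P : Cotangent n M}
    (hP : P.1 ∈ φ.source) {V W : PhaseSpace n → PhaseSpace n}
    (hV : DifferentiableAt ℝ V (inducedChart φ P))
    (hW : DifferentiableAt ℝ W (inducedChart φ P)) :
    mlieBracket (modCot n) (fun Q : Cotangent n M => ofComponents φ Q (V (inducedChart φ Q)))
      (fun Q => ofComponents φ Q (W (inducedChart φ Q))) P =
      ofComponents φ P (lieBracket ℝ V W (inducedChart φ P)) := by
  have h2 : IsManifold (modCot n) (minSmoothness ℝ 2) (Cotangent n M) := by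
    rw [minSmoothness_of_isRCLikeNormedField]; infer_instance
  have h := mpullback_mlieBracket (I := modCot n) (I' := 𝓘(ℝ, ModelE n × ModelE n))
    (mdifferentiableAt_vectorField hV) (mdifferentiableAt_vectorField hW)
    (contMDiffAt_inducedChart hφ hP)
    (by rw [minSmoothness_of_isRCLikeNormedField]; exact WithTop.coe_le_coe.2 le_top)
  have hVW : mlieBracket 𝓘(ℝ, ModelE n × ModelE n) V W = lieBracket ℝ V W :=
    mlieBracketWithin_univ.symm.trans
      (mlieBracketWithin_eq_lieBracketWithin.trans lieBracketWithin_univ)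
  exact h.symm.trans (congrArg
    (fun U => mpullback (modCot n) 𝓘(ℝ, ModelE n × ModelE n) (inducedChart φ) U P) hVW)

-- `J` is prescribed only over the chart domain and off the zero section. Both conditions are open
-- and brackets depend only on germs, so near `P` the fields may be replaced by their coordinate
-- expressions.
open VectorField in
theorem nijenhuis_eq_ofComponents {g : RMetric n M} {φ : OpenPartialHomeomorph M (ModelE n)}
    (hφ : φ ∈ IsManifold.maximalAtlas 𝓘(ℝ, ModelE n) ∞ M) {A : ℝ} {lam b₁ : ℝ → ℝ}
    {J : (P : Cotangent n M) → TangentSpace (modCot n) P →L[ℝ] TangentSpace (modCot n) P}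
    (hJ : IsDiagonalStructure g φ A lam b₁ J) {P : Cotangent n M} (hP : P.1 ∈ φ.source)
    (h0 : P.2 ≠ 0)
    (hd : DifferentiableAt ℝ (CotModel.Jop (chartMetric g φ) A lam b₁) (inducedChart φ P))
    (hJJ : ∀ v, CotModel.Jop (chartMetric g φ) A lam b₁ (inducedChart φ P)
      (CotModel.Jop (chartMetric g φ) A lam b₁ (inducedChart φ P) v) = -v)
    {X Y : (P : Cotangent n M) → TangentSpace (modCot n) P} {V W : PhaseSpace n → PhaseSpace n}
    (hV : DifferentiableAt ℝ V (inducedChart φ P)) (hW : DifferentiableAt ℝ W (inducedChart φ P))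
    (hX : ∀ Q : Cotangent n M, Q.1 ∈ φ.source → X Q = ofComponents φ Q (V (inducedChart φ Q)))
    (hY : ∀ Q : Cotangent n M, Q.1 ∈ φ.source → Y Q = ofComponents φ Q (W (inducedChart φ Q))) :
    nijenhuis (modCot n) J X Y P =
      ofComponents φ P (nijenhuisForm (CotModel.Jop (chartMetric g φ) A lam b₁) (inducedChart φ P)
        (V (inducedChart φ P)) (W (inducedChart φ P))) := by
  have hproj : ContMDiff (modCot n) 𝓘(ℝ, ModelE n) ∞ (fun Q : Cotangent n M => Q.1) :=
    Bundle.contMDiff_proj (fun x : M => TangentSpace 𝓘(ℝ, ModelE n) x →L[ℝ] ℝ)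
  have hs : ∀ᶠ Q : Cotangent n M in nhds P, Q.1 ∈ φ.source :=
    hproj.continuous.continuousAt.eventually (φ.open_source.mem_nhds hP)
  -- Openness of the complement of the zero section is read off the momentum coordinates, which are
  -- continuous and not all zero at `P`.
  have hn : ∀ᶠ Q : Cotangent n M in nhds P, Q.2 ≠ 0 := by
    have h1 : ∀ᶠ Q : Cotangent n M in nhds P, (inducedChart φ Q).2 ≠ 0 :=
      (continuous_snd.continuousAt.comp (contMDiffAt_inducedChart hφ hP).continuousAt).eventually
        (isOpen_ne.mem_nhds (pLow_ne_zero hφ hP h0))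
    filter_upwards [h1] with Q hQ hQ0
    refine hQ ?_
    ext i
    simp [inducedChart, pLow, hQ0]
  have eX : X =ᶠ[nhds P] fun Q => ofComponents φ Q (V (inducedChart φ Q)) :=
    hs.mono fun Q hQ => hX Q hQ
  have eY : Y =ᶠ[nhds P] fun Q => ofComponents φ Q (W (inducedChart φ Q)) :=
    hs.mono fun Q hQ => hY Q hQ
  have eJ : ∀ {Z : (P : Cotangent n M) → TangentSpace (modCot n) P}
      {U : PhaseSpace n → PhaseSpace n},
      (∀ Q : Cotangent n M, Q.1 ∈ φ.source → Z Q = ofComponents φ Q (U (inducedChart φ Q))) →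
      (fun Q => J Q (Z Q)) =ᶠ[nhds P] fun Q => ofComponents φ Q
        ((fun z => CotModel.Jop (chartMetric g φ) A lam b₁ z (U z)) (inducedChart φ Q)) := by
    intro Z U hZ
    filter_upwards [hs, hn] with Q hQ hQ0
    rw [hZ Q hQ, apply_ofComponents hJ hQ hQ0]
  have dV := hd.clm_apply hV
  have dW := hd.clm_apply hW
  rw [nijenhuis, (eJ hX).mlieBracket_vectorField_eq (eJ hY),
    (eJ hX).mlieBracket_vectorField_eq eY, eX.mlieBracket_vectorField_eq (eJ hY),
    eX.mlieBracket_vectorField_eq eY, mlieBracket_ofComponents hφ hP dV dW,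
    mlieBracket_ofComponents hφ hP dV hW, mlieBracket_ofComponents hφ hP hV dW,
    mlieBracket_ofComponents hφ hP hV hW, apply_ofComponents hJ hP h0,
    apply_ofComponents hJ hP h0, ← lieBracket_eq_nijenhuisForm hd hJJ hV hW]
  simp only [ofComponents_sub]

end CotLift

theorem theorem3 {n : ℕ} {M : Type*} [TopologicalSpace M] [ChartedSpace (ModelE n) M]
    [IsManifold 𝓘(ℝ, ModelE n) ∞ M] (g : RMetric n M)
    (A : ℝ) (lam b₁ : ℝ → ℝ)
    (hlam : ContDiffOn ℝ ∞ lam (Set.Ioi 0)) (hb₁ : ContDiffOn ℝ ∞ b₁ (Set.Ioi 0))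
    (hA : 0 < A) (hlam_pos : ∀ t : ℝ, 0 < t → 0 < lam t)
    (hpos : ∀ t : ℝ, 0 < t → 0 < A * lam t + 2 * b₁ t)
    (φ : OpenPartialHomeomorph M (ModelE n)) (hφ : φ ∈ IsManifold.maximalAtlas 𝓘(ℝ, ModelE n) ∞ M)
    (J : (P : Cotangent n M) → TangentSpace (modCot n) P →L[ℝ] TangentSpace (modCot n) P)
    (hJ : CotLift.IsDiagonalStructure g φ A lam b₁ J)
    (P : Cotangent n M) (hP : P.1 ∈ φ.source) (hP0 : P.2 ≠ 0) (i j : Fin n) :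
    nijenhuis (modCot n) J (CotLift.deltaq g φ i) (CotLift.deltaq g φ j) P =
      ∑ k, CotLift.nijComp g φ A lam b₁ P k i j • CotLift.dp φ k P ∧
    nijenhuis (modCot n) J (CotLift.deltaq g φ i) (CotLift.dp φ j) P =
      ∑ k, (∑ l, ∑ r, CotLift.J2 g φ A lam b₁ P k l * CotLift.J2 g φ A lam b₁ P j r *
        CotLift.nijComp g φ A lam b₁ P l i r) • CotLift.deltaq g φ k P ∧
    nijenhuis (modCot n) J (CotLift.dp φ i) (CotLift.dp φ j) P =
      ∑ k, (∑ r, ∑ l, CotLift.J2 g φ A lam b₁ P i r * CotLift.J2 g φ A lam b₁ P j l *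
        CotLift.nijComp g φ A lam b₁ P k l r) • CotLift.dp φ k P := by
  set G := CotLift.chartMetric g φ with hGdef
  set z := CotLift.inducedChart φ P with hz
  have hG : ∀ i j, ContDiffAt ℝ 2 (fun y => G y i j) z.1 :=
    fun i j => CotLift.contDiffAt_chartMetric g hφ hP i j
  have hpd : ∀ᶠ y in nhds z.1, (G y).PosDef := CotLift.eventually_posDef_chartMetric g hφ hP
  have hpz := hpd.self_of_nhds
  have hz2 : z.2 ≠ 0 := CotLift.pLow_ne_zero hφ hP hP0
  have ht : 0 < CotModel.energy G z := CotModel.energy_pos hpz hz2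
  have hl : DifferentiableAt ℝ lam (CotModel.energy G z) :=
    (hlam.contDiffAt (Ioi_mem_nhds ht)).differentiableAt (by simp)
  have hb : DifferentiableAt ℝ b₁ (CotModel.energy G z) :=
    (hb₁.contDiffAt (Ioi_mem_nhds ht)).differentiableAt (by simp)
  -- A neighbourhood is required because J² = -1 gets differentiated. Continuity of the energy keeps
  -- t positive there.
  have had : ∀ᶠ w in nhds z, CotModel.Admissible A lam b₁ (CotModel.energy G w) := by
    filter_upwards [(CotModel.differentiableAt_energy hG hpz).continuousAt.eventually
      (Ioi_mem_nhds ht)] with w hw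
    exact ⟨ne_of_gt hw, (hlam_pos _ hw).ne', (hpos _ hw).ne'⟩
  have ha := had.self_of_nhds
  have hd := CotModel.differentiableAt_Jop hG hpz hl hb hA.ne' ha.energy_ne ha.lam_ne ha.comb_ne
  have hJJ := (CotModel.eventually_Jop_Jop hpd hA.ne' had).self_of_nhds
  have hhor := fun i => CotModel.differentiableAt_horVec hG hpz i
  have hvert : ∀ i, DifferentiableAt ℝ
      (fun _ : PhaseSpace n => ((0 : ModelE n), (stdVec i : ModelE n))) z :=
    fun i => differentiableAt_const _
  refine ⟨?_, ?_, ?_⟩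
  · rw [CotLift.nijenhuis_eq_ofComponents hφ hJ hP hP0 hd hJJ (hhor i) (hhor j)
      (fun Q hQ => CotLift.deltaq_eq hQ i) (fun Q hQ => CotLift.deltaq_eq hQ j),
      CotModel.nijenhuisForm_hor_hor hG hpd hl hb hA.ne' had, CotLift.ofComponents_vert]
    simp only [CotLift.nijComp_eq g hP, ← hGdef, ← hz]
  · rw [CotLift.nijenhuis_eq_ofComponents hφ hJ hP hP0 hd hJJ (hhor i) (hvert j)
      (fun Q hQ => CotLift.deltaq_eq hQ i) (fun Q _ => CotLift.dp_eq j Q),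
      CotModel.nijenhuisForm_hor_vert hG hpd hl hb hA.ne' had, CotLift.ofComponents_sum]
    simp only [CotLift.nijComp_eq g hP, CotLift.J2_eq g hP, CotLift.deltaq_eq hP,
      CotLift.ofComponents_smul, ← hGdef, ← hz]
  · rw [CotLift.nijenhuis_eq_ofComponents hφ hJ hP hP0 hd hJJ (hvert i) (hvert j)
      (fun Q _ => CotLift.dp_eq i Q) (fun Q _ => CotLift.dp_eq j Q),
      CotModel.nijenhuisForm_vert_vert hG hpd hl hb hA.ne' had, CotLift.ofComponents_vert]
    simp only [CotLift.nijComp_eq g hP, CotLift.J2_eq g hP, ← hGdef, ← hz]
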